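/- Let $\mathcal X$ be a measurable space with a dominating measure $dx$ (e.g. $\mathcal X\subseteq\mathbb R^{d_x}$ with Lebesgue measure, or $\mathcal X\subseteq\mathbb Z^{d_x}$ with counting measure). Fix the data $y$, and let $p_\theta(x,y)>0$, $\theta\in\mathbb R^{d}$, $x\in\mathcal X$, be a joint likelihood that is measurable in $x$ and differentiable in $\theta$. Put $U(\theta,x)=-\log p_\theta(x,y)$. Let $\mu_0>0$ be a probability density on $\mathcal X$, let $\theta_0\in\mathbb R^{d}$, let $h=\|\cdot\|^2/2$, and let the step sizes satisfy $0\le\gamma_{n}\le\gamma_{n+1}\le 1$ for $n\ge1$. **Mirror descent iterates.** For $n\ge0$, $$\theta_{n+1}=(\nabla h)^{-1}\Big(\nabla h(\theta_n)-\gamma_{n+1}\int\nabla_\theta U(\theta_n,x)\mu_n(x)\,dx\Big)=\theta_n-\gamma_{n+1}\int\nabla_\theta U(\theta_n,x)\mu_n(x)\,dx,$$ $$\mu_{n+1}(x)\propto\mu_n(x)^{1-\gamma_{n+1}}p_{\theta_n}(x,y)^{\gamma_{n+1}}.$$ For an arbitrary parameter sequence, $\mu_n(\cdot;\theta_{0:n-1})$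 denotes the density obtained from the same recursion for $\mu$, started at $\mu_0$. For $n\ge1$ the weight functions are $$w_n(x;\theta_{0:n-1})=\left(\frac{p_{\theta_{n-1}}(x,y)}{\mu_0(x)^{\prod_{k=1}^{n-1}(1-\gamma_k)}\prod_{j=0}^{n-2}p_{\theta_j}(x,y)^{\gamma_{j+1}\prod_{k=j+2}^{n-1}(1-\gamma_k)}}\right)^{\gamma_n}.$$ **Algorithm (MD-LVM) with $N$ particles.** For $n\ge1$ let $M_n(x,\cdot\,;\theta_{0:n-2})$ be Markov kernels on $\mathcal X$, jointly measurable in $(\theta_{0:n-2},x)$, such that $M_n(\cdot\,;\theta_{0:n-2})$ leaves $\mu_{n-1}(\cdot\,;\theta_{0:n-2})$ invariant. Start from $\theta_0^N=\theta_0$, $X_0^1,\dots,X_0^N$ i.i.d. with density $\mu_0$, and $W_0^i=1/N$. For $n\ge1$: 1. set $\theta_n^N=\theta_{n-1}^N-\gamma_n\sum_{i=1}^N W_{n-1}^i\nabla_\theta U(\theta_{n-1}^N,X_{n-1}^i)$; 2. if $n>1$, draw $\widetilde X_{n-1}^1,\dots,\widetilde X_{n-1}^N$ independently from $\sum_j W_{n-1}^j\delta_{X_{n-1}^j}$;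 if $n=1$, set $\widetilde X_0^i=X_0^i$; 3. draw $X_n^i\sim M_n(\widetilde X_{n-1}^i,\cdot\,;\theta^N_{0:n-2})$ independently over $i$; 4. set $W_n^i=w_n(X_n^i;\theta_{0:n-1}^N)\big/\sum_j w_n(X_n^j;\theta_{0:n-1}^N)$. **Assumptions.** With $B_h(\theta_2|\theta_1)=\tfrac12\|\theta_2-\theta_1\|^2$: * There are $l\ge0$ and $L>0$ such that for all $x,\theta_1,\theta_2$ $$l\,B_h(\theta_2|\theta_1)\le U(\theta_2,x)-U(\theta_1,x)-\langle\nabla_\theta U(\theta_1,x),\theta_2-\theta_1\rangle\le L\,B_h(\theta_2|\theta_1).$$ * For each $n\ge 1$ there is $\rho>0$ such that, for all bounded measurable $\varphi$, all $x$ and all $\theta_{0:n-2},\theta'_{0:n-2}$, $$\Big|\int\varphi\,dM_n(x,\cdot\,;\theta_{0:n-2})-\int\varphi\,dM_n(x,\cdot\,;\theta'_{0:n-2})\Big|\le\rho\|\varphi\|_\infty\sum_{j=0}^{n-2}\|\theta_j-\theta_j'\|.$$ * $\sup_x w_n(x;\theta_{0:n-1})<\infty$ for every $n\ge1$ and every $\theta_{0:n-1}$,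 and $\sup_{\theta,x}\|\nabla_\theta U(\theta,x)\|<\infty$. **Conclusion.** For every $n\ge0$ and every real $p\ge1$ there are finite constants $C_{p,n},D_{p,n}\ge0$, not depending on $N$ or $\varphi$, such that for every $N\ge1$ $$\mathbb E\left[\Big|\sum_{i=1}^NW_n^i\varphi(X_n^i)-\int\varphi(x)\mu_n(x)\,dx\Big|^p\right]^{1/p}\le C_{p,n}\frac{\|\varphi\|_\infty}{N^{1/2}}\quad\text{for every bounded measurable }\varphi:\mathcal X\to\mathbb R,$$ $$\mathbb E\left[\|\theta_n^N-\theta_n\|^p\right]^{1/p}\le D_{p,n}\frac{\gamma_n}{N^{1/2}}.$$ (For $n=0$ the left-hand side of the second bound is $0$, and $\gamma_0$ is an arbitrary number.) -/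

import Mathlib

open MeasureTheory ProbabilityTheory Filter Topology
open scoped ENNReal

noncomputable section

namespace MDLVM

/-- The parameter space `ℝ^d` with its Euclidean norm. -/
abbrev Param (d : ℕ) : Type := EuclideanSpace ℝ (Fin d)

/-! ### Mirror maps and Bregman divergences on the parameter space -/

/-- The Bregman divergence `B_h(a | b) = h a - h b - ⟨∇h(b), a - b⟩`. -/
def bregman {d : ℕ} (h : Param d → ℝ) (a b : Param d) : ℝ :=
  h a - h b - inner ℝ (gradient h b) (a - b)

/-- The potential `h(θ) = ‖θ‖² / 2`. -/
def halfSq (d : ℕ) (θ : Param d) : ℝ := ‖θ‖ ^ 2 / 2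

/-- A mirror descent step with potential `h`, step size `c` and direction `g`:
`(∇h)⁻¹ (∇h(θ) - c g)`. -/
def mirrorStep {d : ℕ} (h : Param d → ℝ) (c : ℝ) (θ g : Param d) : Param d :=
  Function.invFun (gradient h) (gradient h θ - c • g)

theorem gradient_halfSq (d : ℕ) (θ : Param d) : gradient (halfSq d) θ = θ := by
  apply HasGradientAt.gradient
  rw [hasGradientAt_iff_hasFDerivAt]
  have h1 := ((hasStrictFDerivAt_norm_sq θ).hasFDerivAt).mul_const (2⁻¹ : ℝ)
  have h2 : (halfSq d) = fun y : Param d => ‖y‖ ^ 2 * (2⁻¹ : ℝ) := by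
    funext y
    simp [halfSq, div_eq_mul_inv]
  rw [h2]
  refine h1.congr_fderiv ?_
  ext y
  simp

theorem mirrorStep_halfSq {d : ℕ} (c : ℝ) (θ g : Param d) :
    mirrorStep (halfSq d) c θ g = θ - c • g := by
  have h : gradient (halfSq d) = id := funext (gradient_halfSq d)
  rw [mirrorStep, h]
  exact Function.leftInverse_invFun Function.injective_id _

/-! ### The latent variable model -/

/-- A latent variable model with the data `y` fixed, and an initial distribution. Here `ref` is the
dominating measure ("dx") on the latent space, `p θ x` is the joint likelihood `p_θ(x, y)`, and
`mu0` is the density of the initial distribution. -/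
structure LatentModel (d : ℕ) (X : Type*) [MeasurableSpace X] where
  ref : Measure X
  p : Param d → X → ℝ
  p_pos : ∀ θ x, 0 < p θ x
  p_meas : ∀ θ, Measurable (p θ)
  p_diff : ∀ x, Differentiable ℝ (fun θ => p θ x)
  mu0 : X → ℝ
  mu0_pos : ∀ x, 0 < mu0 x
  mu0_meas : Measurable mu0
  mu0_mass : ∫ x, mu0 x ∂ref = 1

namespace LatentModel

variable {d : ℕ} {X : Type*} [MeasurableSpace X] (m : LatentModel d X)

/-- The negative log-likelihood `U(θ, x) = - log p_θ(x, y)`. -/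
def U (θ : Param d) (x : X) : ℝ := -Real.log (m.p θ x)

/-- The gradient `∇_θ U(θ, x)`. -/
def gradU (θ : Param d) (x : X) : Param d := gradient (fun ϑ => m.U ϑ x) θ

/-- `θ ↦ U(θ, x)` is `l`-relatively convex with respect to `h`, uniformly in `x`. -/
def RelConvex (h : Param d → ℝ) (l : ℝ) : Prop :=
  ∀ (x : X) (θ₁ θ₂ : Param d),
    m.U θ₁ x + inner ℝ (m.gradU θ₁ x) (θ₂ - θ₁) + l * bregman h θ₂ θ₁ ≤ m.U θ₂ x

/-- `θ ↦ U(θ, x)` is `L`-relatively smooth with respect to `h`, uniformly in `x`. -/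
def RelSmooth (h : Param d → ℝ) (L : ℝ) : Prop :=
  ∀ (x : X) (θ₁ θ₂ : Param d),
    m.U θ₂ x ≤ m.U θ₁ x + inner ℝ (m.gradU θ₁ x) (θ₂ - θ₁) + L * bregman h θ₂ θ₁

/-- `sup ‖∇_θ U‖ < ∞`, the supremum being over all `θ` and `x`. -/
def GradBounded : Prop := ∃ B : ℝ, ∀ θ x, ‖m.gradU θ x‖ ≤ B

/-! ### The mirror descent iterates -/

/-- One step of the `μ`-update: the density proportional to `μ(x)^(1-c) p_θ(x, y)^c`. -/
def muStep (c : ℝ) (θ : Param d) (μ : X → ℝ) (x : X) : ℝ :=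
  (μ x ^ (1 - c) * m.p θ x ^ c) / ∫ v, μ v ^ (1 - c) * m.p θ v ^ c ∂m.ref

/-- The mirror descent iterates `(θ_n, μ_n)` with potential `h`, started at `(θ0, mu0)`. -/
def iter (h : Param d → ℝ) (γ : ℕ → ℝ) (θ0 : Param d) : ℕ → Param d × (X → ℝ)
  | 0 => (θ0, m.mu0)
  | n + 1 =>
      let s := iter h γ θ0 n
      (mirrorStep h (γ (n + 1)) s.1 (∫ x, s.2 x • m.gradU s.1 x ∂m.ref),
        m.muStep (γ (n + 1)) s.1 s.2)

/-- The density `μ_n(x; θ_{0:n-1})` that the `μ`-update gives along an arbitrary sequence of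
parameters; it depends only on `θ 0, …, θ (n - 1)`. -/
def muAlong (γ : ℕ → ℝ) (θ : ℕ → Param d) : ℕ → X → ℝ
  | 0 => m.mu0
  | n + 1 => m.muStep (γ (n + 1)) (θ n) (muAlong γ θ n)

/-- The weight function `w_{n+1}(x; θ_{0:n})`; it depends only on `θ 0, …, θ n`. -/
def weight (γ : ℕ → ℝ) (n : ℕ) (θ : ℕ → Param d) (x : X) : ℝ :=
  (m.p (θ n) x /
    (m.mu0 x ^ (∏ k ∈ Finset.Icc 1 n, (1 - γ k)) *
      ∏ j ∈ Finset.range n,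
        m.p (θ j) x ^ (γ (j + 1) * ∏ k ∈ Finset.Icc (j + 2) n, (1 - γ k)))) ^ γ (n + 1)

/-- Each weight function `w_{n+1}(· ; θ_{0:n})` is bounded above on the latent space. -/
def WeightsBounded (γ : ℕ → ℝ) : Prop :=
  ∀ (n : ℕ) (θ : ℕ → Param d), ∃ K : ℝ, ∀ x, m.weight γ n θ x ≤ K

/-! ### Assumptions on the Markov kernels

`M n` stands for the kernel `M_{n+1}(x, · ; θ_{0:n-1})`, a Markov kernel in `x` that depends on the
`n` parameters `θ_0, …, θ_{n-1}`. -/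

/-- `M_{n+1}(· ; θ_{0:n-1})` leaves the distribution `μ_n(· ; θ_{0:n-1})` invariant. -/
def KernelsInvariant (γ : ℕ → ℝ) (M : (n : ℕ) → Kernel ((Fin n → Param d) × X) X) : Prop :=
  ∀ (n : ℕ) (θ : ℕ → Param d),
    Kernel.Invariant ((M n).sectR (fun j : Fin n => θ j))
      (m.ref.withDensity fun x => ENNReal.ofReal (m.muAlong γ θ n x))

end LatentModel

/-- Stability of the Markov kernels with respect to the parameters. -/
def KernelsStable {d : ℕ} {X : Type*} [MeasurableSpace X]
    (M : (n : ℕ) → Kernel ((Fin n → Param d) × X) X) : Prop :=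
  ∀ n : ℕ, ∃ ρ : ℝ, 0 < ρ ∧ ∀ φ : X → ℝ, Measurable φ → (∃ K : ℝ, ∀ x, |φ x| ≤ K) →
    ∀ (θ θ' : Fin n → Param d) (x : X),
      |∫ v, φ v ∂(M n (θ, x)) - ∫ v, φ v ∂(M n (θ', x))| ≤
        ρ * (⨆ v, |φ v|) * ∑ j, ‖θ j - θ' j‖

/-! ### Measurability facts needed to build the law of the algorithm -/

theorem measurable_pi_measure {S X ι : Type*} [MeasurableSpace S] [MeasurableSpace X] [Fintype ι]
    (κ : ι → S → Measure X) [∀ i s, IsProbabilityMeasure (κ i s)] (hκ : ∀ i, Measurable (κ i)) :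
    Measurable fun s => Measure.pi fun i => κ i s := by
  refine Measurable.measure_of_isPiSystem_of_isProbabilityMeasure generateFrom_pi.symm
    isPiSystem_pi ?_
  rintro _ ⟨t, ht, rfl⟩
  simp only [Measure.pi_pi]
  refine Finset.measurable_prod _ fun i _ => ?_
  exact (Measure.measurable_coe (ht i (Set.mem_univ i))).comp (hκ i)

namespace LatentModel

variable {d : ℕ} {X : Type*} [MeasurableSpace X] (m : LatentModel d X)

theorem measurable_p : Measurable fun q : Param d × X => m.p q.1 q.2 :=
  measurable_uncurry_of_continuous_of_measurable (u := m.p)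
    (fun x => (m.p_diff x).continuous) m.p_meas

theorem measurable_U : Measurable fun q : Param d × X => m.U q.1 q.2 :=
  (Real.measurable_log.comp m.measurable_p).neg

theorem differentiable_U (x : X) : Differentiable ℝ fun θ => m.U θ x :=
  ((m.p_diff x).log fun θ => (m.p_pos θ x).ne').neg

theorem measurable_gradU : Measurable fun q : Param d × X => m.gradU q.1 q.2 := by
  have key : ∀ i : Fin d, Measurable fun q : Param d × X => m.gradU q.1 q.2 i := by
    intro i
    let e : Param d := EuclideanSpace.single i (1 : ℝ)
    let t : ℕ → ℝ := fun k => 1 / ((k : ℝ) + 1)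
    have ht0 : Tendsto t atTop (𝓝[≠] 0) := by
      refine tendsto_nhdsWithin_iff.2 ⟨tendsto_one_div_add_atTop_nhds_zero_nat, ?_⟩
      exact Filter.Eventually.of_forall fun k => (Nat.one_div_pos_of_nat (α := ℝ)).ne'
    refine measurable_of_tendsto_metrizable
      (f := fun (k : ℕ) (q : Param d × X) =>
        (t k)⁻¹ * (m.U (q.1 + t k • e) q.2 - m.U q.1 q.2)) ?_ ?_
    · intro k
      have h1 : Measurable fun q : Param d × X => (q.1 + t k • e, q.2) :=
        (measurable_fst.add_const _).prodMk measurable_snd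
      exact ((m.measurable_U.comp h1).sub m.measurable_U).const_mul _
    · rw [tendsto_pi_nhds]
      rintro ⟨θ, x⟩
      have hg := (m.differentiable_U x θ).hasGradientAt
      have hl := hg.hasFDerivAt.hasLineDerivAt e
      have h2 := (hasDerivAt_iff_tendsto_slope_zero.1 hl).comp ht0
      have h3 : m.gradU θ x i = (InnerProductSpace.toDual ℝ (Param d)
          (gradient (fun ϑ => m.U ϑ x) θ)) e := by
        rw [InnerProductSpace.toDual_apply_apply, EuclideanSpace.inner_single_right]
        simp [gradU]
      rw [h3]
      simpa [Function.comp_def] using h2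
  have h : (fun q : Param d × X => m.gradU q.1 q.2) =
      fun q => WithLp.toLp 2 (fun i => m.gradU q.1 q.2 i) := rfl
  rw [h]
  exact (WithLp.measurable_toLp 2 _).comp (measurable_pi_lambda _ key)

theorem measurable_weight (γ : ℕ → ℝ) (n : ℕ) :
    Measurable fun q : (ℕ → Param d) × X => m.weight γ n q.1 q.2 := by
  have hp : ∀ j : ℕ, Measurable fun q : (ℕ → Param d) × X => m.p (q.1 j) q.2 := fun j =>
    m.measurable_p.comp
      (g := fun q : Param d × X => m.p q.1 q.2) (f := fun q : (ℕ → Param d) × X => (q.1 j, q.2))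
      (((measurable_pi_apply j).comp measurable_fst).prodMk measurable_snd)
  unfold weight
  refine Measurable.pow_const ((hp n).div (Measurable.mul ?_ ?_)) _
  · exact (m.mu0_meas.comp measurable_snd).pow_const _
  · exact Finset.measurable_prod _ fun j _ => (hp j).pow_const _

theorem weight_pos (γ : ℕ → ℝ) (n : ℕ) (θ : ℕ → Param d) (x : X) : 0 < m.weight γ n θ x := by
  unfold weight
  refine Real.rpow_pos_of_pos (div_pos (m.p_pos _ _) (mul_pos ?_ ?_)) _
  · exact Real.rpow_pos_of_pos (m.mu0_pos x) _
  · exact Finset.prod_pos fun j _ => Real.rpow_pos_of_pos (m.p_pos _ _) _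

/-- The initial distribution as a measure. -/
def mu0Measure : Measure X := m.ref.withDensity fun x => ENNReal.ofReal (m.mu0 x)

instance : IsProbabilityMeasure m.mu0Measure := by
  constructor
  have hi : Integrable m.mu0 m.ref := by
    by_contra hc
    have h := m.mu0_mass
    rw [integral_undef hc] at h
    exact zero_ne_one h
  rw [mu0Measure, withDensity_apply _ MeasurableSet.univ, Measure.restrict_univ,
    ← ofReal_integral_eq_lintegral_ofReal hi
      (Filter.Eventually.of_forall fun x => (m.mu0_pos x).le), m.mu0_mass, ENNReal.ofReal_one]

end LatentModel

/-! ### The MD-LVM algorithm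

The state of the algorithm after `n` iterations consists of the parameters
`θ_0^N, …, θ_n^N` (the first `n + 1` entries of a sequence, whose further entries are never read)
and of the particles `X_n^1, …, X_n^N`; the normalised weights `W_n^i` are functions of the
state. -/

/-- The memory of the algorithm with `N` particles. -/
abbrev State (d : ℕ) (X : Type*) (N : ℕ) : Type _ := (ℕ → Param d) × (Fin N → X)

namespace LatentModel

variable {d : ℕ} {X : Type*} [MeasurableSpace X] (m : LatentModel d X)

/-- The normalised weights: `W_0^i = 1/N` and `W_{n+1}^i ∝ w_{n+1}(X_{n+1}^i; θ_{0:n}^N)`. -/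
def W (γ : ℕ → ℝ) {N : ℕ} : ℕ → State d X N → Fin N → ℝ
  | 0, _, _ => 1 / (N : ℝ)
  | n + 1, s, i => m.weight γ n s.1 (s.2 i) / ∑ j, m.weight γ n s.1 (s.2 j)

theorem measurable_W (γ : ℕ → ℝ) {N : ℕ} (n : ℕ) (i : Fin N) :
    Measurable fun s : State d X N => m.W γ n s i := by
  cases n with
  | zero => exact measurable_const
  | succ n =>
    have hw : ∀ j : Fin N, Measurable fun s : State d X N => m.weight γ n s.1 (s.2 j) := fun j =>
      (m.measurable_weight γ n).comp
        (measurable_fst.prodMk ((measurable_pi_apply j).comp measurable_snd))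
    exact (hw i).div (Finset.measurable_sum _ fun j _ => hw j)

theorem W_nonneg (γ : ℕ → ℝ) {N : ℕ} (n : ℕ) (s : State d X N) (i : Fin N) :
    0 ≤ m.W γ n s i := by
  cases n with
  | zero => simp [W]
  | succ n =>
    exact div_nonneg (m.weight_pos _ _ _ _).le (Finset.sum_nonneg fun j _ => (m.weight_pos _ _ _ _).le)

theorem sum_W (γ : ℕ → ℝ) {N : ℕ} [NeZero N] (n : ℕ) (s : State d X N) :
    ∑ i, m.W γ n s i = 1 := by
  cases n with
  | zero => simp [W, NeZero.ne N]
  | succ n =>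
    have h : 0 < ∑ j, m.weight γ n s.1 (s.2 j) :=
      Finset.sum_pos (fun j _ => m.weight_pos _ _ _ _) Finset.univ_nonempty
    simp only [W]
    rw [← Finset.sum_div, div_self h.ne']

/-- The update of the parameter: the sequence `θ_0^N, …, θ_n^N` is extended by
`θ_{n+1}^N = (∇h)⁻¹ (∇h(θ_n^N) - γ_{n+1} ∑_i W_n^i ∇_θ U(θ_n^N, X_n^i))`, with `h = ‖·‖²/2`. -/
def thetaUpdate (γ : ℕ → ℝ) {N : ℕ} (n : ℕ) (s : State d X N) : ℕ → Param d :=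
  Function.update s.1 (n + 1)
    (mirrorStep (halfSq d) (γ (n + 1)) (s.1 n) (∑ i, m.W γ n s i • m.gradU (s.1 n) (s.2 i)))

theorem measurable_thetaUpdate (γ : ℕ → ℝ) {N : ℕ} (n : ℕ) :
    Measurable fun s : State d X N => m.thetaUpdate γ n s := by
  have h1 : Measurable fun s : State d X N => s.1 n :=
    (measurable_pi_apply n).comp measurable_fst
  have h2 : Measurable fun s : State d X N =>
      ∑ i, m.W γ n s i • m.gradU (s.1 n) (s.2 i) := by
    refine Finset.measurable_sum _ fun i _ => (m.measurable_W γ n i).smul ?_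
    exact m.measurable_gradU.comp (h1.prodMk ((measurable_pi_apply i).comp measurable_snd))
  have h3 : Measurable fun s : State d X N =>
      s.1 n - γ (n + 1) • ∑ i, m.W γ n s i • m.gradU (s.1 n) (s.2 i) :=
    h1.sub (h2.const_smul (γ (n + 1)))
  unfold thetaUpdate
  simp only [mirrorStep_halfSq]
  refine measurable_pi_lambda _ fun k => ?_
  by_cases hk : k = n + 1
  · subst hk
    simpa only [Function.update_self] using h3
  · simp only [Function.update_of_ne hk]
    exact (measurable_pi_apply k).comp measurable_fst

/-- The distribution from which a resampled particle is drawn: `∑_j W_n^j δ_{X_n^j}`. -/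
def resampleOne (γ : ℕ → ℝ) {N : ℕ} (n : ℕ) (s : State d X N) : Measure X :=
  ∑ j, ENNReal.ofReal (m.W γ n s j) • Measure.dirac (s.2 j)

instance (γ : ℕ → ℝ) {N : ℕ} [NeZero N] (n : ℕ) (s : State d X N) :
    IsProbabilityMeasure (m.resampleOne γ n s) := by
  constructor
  simp only [resampleOne, Measure.coe_finsetSum, Finset.sum_apply, Measure.smul_apply,
    measure_univ, smul_eq_mul, mul_one]
  rw [← ENNReal.ofReal_sum_of_nonneg fun j _ => m.W_nonneg γ n s j, sum_W, ENNReal.ofReal_one]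

theorem measurable_resampleOne (γ : ℕ → ℝ) {N : ℕ} (n : ℕ) :
    Measurable fun s : State d X N => m.resampleOne γ n s := by
  refine Measure.measurable_of_measurable_coe _ fun t ht => ?_
  simp only [resampleOne, Measure.coe_finsetSum, Finset.sum_apply, Measure.smul_apply,
    smul_eq_mul]
  refine Finset.measurable_sum _ fun j _ => ?_
  refine (m.measurable_W γ n j).ennreal_ofReal.mul ?_
  exact (Measure.measurable_coe ht).comp
    (Measure.measurable_dirac.comp ((measurable_pi_apply j).comp measurable_snd))

/-- The resampling step: given the state at time `n`, the law of the particles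
`X̃_n^1, …, X̃_n^N`. For `n = 0` there is no resampling, `X̃_0^i = X_0^i`; for `n ≥ 1` they are
drawn independently from `∑_j W_n^j δ_{X_n^j}`. -/
def resample (γ : ℕ → ℝ) (N : ℕ) [NeZero N] : ℕ → Kernel (State d X N) (Fin N → X)
  | 0 => Kernel.deterministic Prod.snd measurable_snd
  | n + 1 =>
    { toFun := fun s => Measure.pi fun _ : Fin N => m.resampleOne γ (n + 1) s
      measurable' := measurable_pi_measure (fun _ s => m.resampleOne γ (n + 1) s)
        fun _ => m.measurable_resampleOne γ (n + 1) }

instance (γ : ℕ → ℝ) (N : ℕ) [NeZero N] (n : ℕ) : IsMarkovKernel (m.resample γ N n) := by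
  cases n with
  | zero => exact Kernel.isMarkovKernel_deterministic measurable_snd
  | succ n =>
    refine ⟨fun s => ?_⟩
    change IsProbabilityMeasure (Measure.pi fun _ : Fin N => m.resampleOne γ (n + 1) s)
    infer_instance

/-- The proposal step: given the state at time `n` and the resampled particles, the new particles
are drawn independently, `X_{n+1}^i ∼ M_{n+1}(X̃_n^i, · ; θ_{0:n-1}^N)`. -/
def propose (M : (n : ℕ) → Kernel ((Fin n → Param d) × X) X) [∀ n, IsMarkovKernel (M n)]
    (N n : ℕ) : Kernel (State d X N × (Fin N → X)) (Fin N → X) where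
  toFun q := Measure.pi fun i : Fin N => M n (fun j : Fin n => q.1.1 j, q.2 i)
  measurable' := by
    refine measurable_pi_measure
      (fun i (q : State d X N × (Fin N → X)) => M n (fun j : Fin n => q.1.1 j, q.2 i)) fun i => ?_
    refine (M n).measurable.comp (Measurable.prodMk ?_ ?_)
    · exact measurable_pi_lambda _ fun j =>
        (measurable_pi_apply _).comp (measurable_fst.comp measurable_fst)
    · exact (measurable_pi_apply i).comp measurable_snd

instance (M : (n : ℕ) → Kernel ((Fin n → Param d) × X) X) [∀ n, IsMarkovKernel (M n)]
    (N n : ℕ) : IsMarkovKernel (propose M N n) := by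
  refine ⟨fun q => ?_⟩
  change IsProbabilityMeasure
    (Measure.pi fun i : Fin N => M n (fun j : Fin n => q.1.1 j, q.2 i))
  infer_instance

/-- One iteration of the algorithm, from time `n` to time `n + 1`. -/
def step (γ : ℕ → ℝ) (M : (n : ℕ) → Kernel ((Fin n → Param d) × X) X) [∀ n, IsMarkovKernel (M n)]
    (N : ℕ) [NeZero N] (n : ℕ) : Kernel (State d X N) (State d X N) :=
  (Kernel.deterministic (fun s => m.thetaUpdate γ n s) (m.measurable_thetaUpdate γ n)) ×ₖ
    ((propose M N n) ∘ₖ (Kernel.id ×ₖ m.resample γ N n))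

/-- The law of the state of the algorithm at time `n`, when it is started from the deterministic
parameter `θ0` and `N` independent particles with density `mu0`. -/
def law (γ : ℕ → ℝ) (M : (n : ℕ) → Kernel ((Fin n → Param d) × X) X) [∀ n, IsMarkovKernel (M n)]
    (θ0 : Param d) (N : ℕ) [NeZero N] : ℕ → Measure (State d X N)
  | 0 => (Measure.dirac fun _ => θ0).prod (Measure.pi fun _ : Fin N => m.mu0Measure)
  | n + 1 => (law γ M θ0 N n).bind (m.step γ M N n)

instance (γ : ℕ → ℝ) (M : (n : ℕ) → Kernel ((Fin n → Param d) × X) X) [∀ n, IsMarkovKernel (M n)]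
    (N : ℕ) [NeZero N] (n : ℕ) : IsMarkovKernel (m.step γ M N n) := by
  unfold step
  infer_instance

instance (γ : ℕ → ℝ) (M : (n : ℕ) → Kernel ((Fin n → Param d) × X) X) [∀ n, IsMarkovKernel (M n)]
    (θ0 : Param d) (N : ℕ) [NeZero N] (n : ℕ) : IsProbabilityMeasure (m.law γ M θ0 N n) := by
  induction n with
  | zero => unfold law; infer_instance
  | succ n ih => unfold law; infer_instance

end LatentModel

end MDLVM

end

noncomputable section

namespace MDLVM

/-! ### Bounds on `L^p` norms -/

/-! Fix $p$ and induct on time. The hypothesis carried along is an $O(N^{-1/2})$ bound in $L^p$ for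
the weighted particle means of all bounded test functions, together with one for every past
parameter $\theta_j^N$, $j\le n$, since kernels and weights read the whole history.

Particles. The error of the proposed particles splits into sampling noise of the proposal, the
effect of using $\theta^N$ instead of $\theta$ in the kernel, resampling noise, and the error
inherited from time $n$ at the test function $M_{n+1}\varphi$. Conditionally on the past, both
noises are means of independent bounded variables (`lpBound_mean_sub_mean`). The kernel term is
controlled by stability, and invariance identifies the limit $\mu_n(M_{n+1}\varphi)=\mu_n(\varphi)$
(`lpBound_jointLaw`).

Weights. The update of $\mu$ is an importance reweighting, $\mu_{n+1}\propto w_{n+1}\mu_n$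
(`muAlong_spec`), and $\log w_{n+1}$ is Lipschitz in the parameters uniformly in $x$
(`weight_le_exp_mul`). Random weights can therefore be exchanged for those at the exact parameters,
and a ratio of means remains (`lpBound_weightedMean_succ`). Upper bounds and normalising constants
are needed only along the exact trajectory, so the constants do not depend on $N$.

Parameters. Relative convexity and smoothness make $\nabla_\theta U$ Lipschitz in $\theta$, so one
gradient step adds $\gamma_{n+1}$ times an $O(N^{-1/2})$ error; monotone step sizes absorb the
earlier factor $\gamma_n$ into $\gamma_{n+1}$ (`lpBound_thetaUpdate`). -/

/-- `f` is a.e. strongly measurable with `L^p` norm at most `c`. -/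
structure LpBound {Ω : Type*} [MeasurableSpace Ω] (p : ℝ) (μ : Measure Ω) (f : Ω → ℝ) (c : ℝ) :
    Prop where
  aesm : AEStronglyMeasurable f μ
  norm_le : eLpNorm f (ENNReal.ofReal p) μ ≤ ENNReal.ofReal c

namespace LpBound

variable {Ω : Type*} [MeasurableSpace Ω] {p : ℝ} {μ : Measure Ω} {f g : Ω → ℝ} {c c' : ℝ}

theorem weaken (hf : LpBound p μ f c) (h : c ≤ c') : LpBound p μ f c' :=
  ⟨hf.aesm, hf.norm_le.trans (ENNReal.ofReal_le_ofReal h)⟩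

theorem mono (hf : LpBound p μ f c) (hg : AEStronglyMeasurable g μ)
    (h : ∀ ω, |g ω| ≤ |f ω|) :
    LpBound p μ g c :=
  ⟨hg, (eLpNorm_mono (by simpa only [Real.norm_eq_abs] using h)).trans hf.norm_le⟩

theorem abs (hf : LpBound p μ f c) : LpBound p μ (fun ω => |f ω|) c :=
  hf.mono (continuous_abs.comp_aestronglyMeasurable hf.aesm) fun _ => (abs_abs _).le

theorem zero : LpBound p μ (fun _ => 0) c :=
  ⟨aestronglyMeasurable_const, by simp⟩

theorem add (hp : 1 ≤ p) (hf : LpBound p μ f c) (hg : LpBound p μ g c') (hc : 0 ≤ c)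
    (hc' : 0 ≤ c') : LpBound p μ (fun ω => f ω + g ω) (c + c') := by
  refine ⟨hf.aesm.add hg.aesm, ?_⟩
  refine (eLpNorm_add_le hf.aesm hg.aesm (ENNReal.one_le_ofReal.2 hp)).trans ?_
  rw [ENNReal.ofReal_add hc hc']
  exact add_le_add hf.norm_le hg.norm_le

theorem const_mul (hf : LpBound p μ f c) {a : ℝ} (ha : 0 ≤ a) :
    LpBound p μ (fun ω => a * f ω) (a * c) := by
  refine ⟨hf.aesm.const_mul a, ?_⟩
  have h := eLpNorm_const_smul_le (c := a) (f := f) (p := ENNReal.ofReal p) (μ := μ)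
  refine h.trans ?_
  rw [ENNReal.ofReal_mul ha, Real.enorm_eq_ofReal ha]
  exact mul_le_mul_right hf.norm_le _

theorem sum (hp : 1 ≤ p) {ι : Type*} (s : Finset ι) {f : ι → Ω → ℝ} {c : ι → ℝ}
    (hf : ∀ i ∈ s, LpBound p μ (f i) (c i)) (hc : ∀ i ∈ s, 0 ≤ c i) :
    LpBound p μ (fun ω => ∑ i ∈ s, f i ω) (∑ i ∈ s, c i) := by
  classical
  induction s using Finset.induction_on with
  | empty => simpa using zero
  | insert a s ha ih =>
    simp only [Finset.sum_insert ha]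
    exact (hf a (Finset.mem_insert_self a s)).add hp
      (ih (fun i hi => hf i (Finset.mem_insert_of_mem hi))
        fun i hi => hc i (Finset.mem_insert_of_mem hi))
      (hc a (Finset.mem_insert_self a s))
      (Finset.sum_nonneg fun i hi => hc i (Finset.mem_insert_of_mem hi))

theorem comp_map {Ω' : Type*} [MeasurableSpace Ω'] {T : Ω → Ω'} {f : Ω' → ℝ}
    (hf : LpBound p (μ.map T) f c) (hT : Measurable T) : LpBound p μ (fun ω => f (T ω)) c :=
  ⟨hf.aesm.comp_measurable hT, by
    rw [← Function.comp_def, ← eLpNorm_map_measure hf.aesm hT.aemeasurable]; exact hf.norm_le⟩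

theorem of_comp_map {Ω' : Type*} [MeasurableSpace Ω'] {T : Ω → Ω'} {f : Ω' → ℝ}
    (hT : Measurable T) (hf : AEStronglyMeasurable f (μ.map T))
    (h : LpBound p μ (fun ω => f (T ω)) c) : LpBound p (μ.map T) f c :=
  ⟨hf, by rw [eLpNorm_map_measure hf hT.aemeasurable]; exact h.norm_le⟩

/-- Drawing further randomness from a Markov kernel does not change the law of what was there
before. -/
theorem comp_fst [SFinite μ] {Ω' : Type*} [MeasurableSpace Ω'] (κ : Kernel Ω Ω')
    [IsMarkovKernel κ] (hf : LpBound p μ f c) :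
    LpBound p (μ ⊗ₘ κ) (fun ω => f ω.1) c := by
  refine comp_map (T := Prod.fst) (f := f) ?_ measurable_fst
  rw [← Measure.fst, Measure.fst_compProd]
  exact hf

/-- The tool for conditioning: a bound on the conditional $p$-th moment that is uniform in the past
integrates to the same unconditional bound. -/
theorem compProd [IsProbabilityMeasure μ] {Ω' : Type*} [MeasurableSpace Ω'] {κ : Kernel Ω Ω'}
    [IsMarkovKernel κ] (hp : 1 ≤ p) {f : Ω × Ω' → ℝ} (hf : Measurable f)
    (h : ∀ ω, LpBound p (κ ω) (fun ω' => f (ω, ω')) c) : LpBound p (μ ⊗ₘ κ) f c := by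
  refine ⟨hf.aestronglyMeasurable, ?_⟩
  have hp0 : 0 < p := one_pos.trans_le hp
  have hq0 : ENNReal.ofReal p ≠ 0 := (ENNReal.ofReal_pos.2 hp0).ne'
  have key : ∀ ω, ∫⁻ ω', ‖f (ω, ω')‖ₑ ^ p ∂(κ ω) ≤ ENNReal.ofReal c ^ p := by
    intro ω
    have := (h ω).norm_le
    rw [eLpNorm_eq_lintegral_rpow_enorm_toReal hq0 ENNReal.ofReal_ne_top,
      ENNReal.toReal_ofReal hp0.le, one_div, ENNReal.rpow_inv_le_iff hp0] at this
    exact this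
  rw [eLpNorm_eq_lintegral_rpow_enorm_toReal hq0 ENNReal.ofReal_ne_top,
    ENNReal.toReal_ofReal hp0.le, one_div, ENNReal.rpow_inv_le_iff hp0,
    Measure.lintegral_compProd (hf.enorm.pow_const p)]
  calc ∫⁻ ω, ∫⁻ ω', ‖f (ω, ω')‖ₑ ^ p ∂(κ ω) ∂μ ≤ ∫⁻ _, ENNReal.ofReal c ^ p ∂μ :=
        lintegral_mono key
    _ = ENNReal.ofReal c ^ p := by simp

end LpBound

/-! ### A Marcinkiewicz–Zygmund inequality for bounded variables -/

theorem rpow_le_factorial_mul_exp {p u : ℝ} (hp : 0 ≤ p) (hu : 0 ≤ u) :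
    u ^ p ≤ (Nat.factorial ⌈p⌉₊ : ℝ) * Real.exp u := by
  have hf : (1 : ℝ) ≤ Nat.factorial ⌈p⌉₊ := by exact_mod_cast Nat.factorial_pos _
  rcases le_total u 1 with h | h
  · calc u ^ p ≤ 1 := Real.rpow_le_one hu h hp
      _ ≤ (Nat.factorial ⌈p⌉₊ : ℝ) * Real.exp u :=
        one_le_mul_of_one_le_of_one_le hf (Real.one_le_exp hu)
  · calc u ^ p ≤ u ^ (⌈p⌉₊ : ℝ) := Real.rpow_le_rpow_of_exponent_le h (Nat.le_ceil p)
      _ = u ^ ⌈p⌉₊ := Real.rpow_natCast _ _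
      _ ≤ (Nat.factorial ⌈p⌉₊ : ℝ) * Real.exp u := by
        rw [mul_comm]
        exact (div_le_iff₀ (by positivity)).1 (Real.pow_div_factorial_le_exp u hu _)

/-- The constant in the moment bound for empirical means. -/
def momentConst (p : ℝ) : ℝ := (Nat.factorial ⌈p⌉₊ * (2 * Real.exp (1 / 2))) ^ p⁻¹

theorem momentConst_nonneg (p : ℝ) : 0 ≤ momentConst p := by
  unfold momentConst; positivity

/-- Since $|f|^p\le\lceil p\rceil!\,e^{|f|}\le\lceil p\rceil!\,(e^{f}+e^{-f})$, the moment
generating function at $\pm1$ suffices; each value is at most $e^{1/2}$. -/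
theorem LpBound.of_hasSubgaussianMGF {Ω : Type*} [MeasurableSpace Ω] {μ : Measure Ω} {p : ℝ}
    (hp : 1 ≤ p) {f : Ω → ℝ} (hf : HasSubgaussianMGF f 1 μ) : LpBound p μ f (momentConst p) := by
  refine ⟨hf.aestronglyMeasurable, ?_⟩
  have hp0 : 0 < p := one_pos.trans_le hp
  rw [eLpNorm_eq_lintegral_rpow_enorm_toReal (ENNReal.ofReal_pos.2 hp0).ne' ENNReal.ofReal_ne_top,
    ENNReal.toReal_ofReal hp0.le, one_div, ENNReal.rpow_inv_le_iff hp0, momentConst,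
    ENNReal.ofReal_rpow_of_nonneg (by positivity) hp0.le,
    Real.rpow_inv_rpow (by positivity) hp0.ne']
  have h1 := hf.integrable_exp_mul 1
  have h2 := hf.integrable_exp_mul (-1)
  have m1 := hf.mgf_le 1
  have m2 := hf.mgf_le (-1)
  simp only [mgf, NNReal.coe_one, one_mul, neg_mul, neg_sq, one_pow] at m1 m2 h1 h2
  have hint := (h1.add h2).const_mul (Nat.factorial ⌈p⌉₊ : ℝ)
  calc ∫⁻ ω, ‖f ω‖ₑ ^ p ∂μ
      ≤ ∫⁻ ω, ENNReal.ofReal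
          ((Nat.factorial ⌈p⌉₊ : ℝ) * (Real.exp (f ω) + Real.exp (-f ω))) ∂μ := by
        refine lintegral_mono fun ω => ?_
        rw [Real.enorm_eq_ofReal_abs, ENNReal.ofReal_rpow_of_nonneg (abs_nonneg _) hp0.le]
        refine ENNReal.ofReal_le_ofReal
          ((rpow_le_factorial_mul_exp hp0.le (abs_nonneg _)).trans ?_)
        gcongr
        rcases abs_cases (f ω) with h | h <;> rw [h.1]
        · linarith [Real.exp_pos (-f ω)]
        · linarith [Real.exp_pos (f ω)]
    _ = ENNReal.ofReal (∫ ω, (Nat.factorial ⌈p⌉₊ : ℝ) * (Real.exp (f ω) + Real.exp (-f ω)) ∂μ) :=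
        (ofReal_integral_eq_lintegral_ofReal hint
          (Eventually.of_forall fun ω => by simp only [Pi.add_apply, Pi.zero_apply]; positivity)).symm
    _ ≤ _ := by
        refine ENNReal.ofReal_le_ofReal ?_
        rw [integral_const_mul, integral_add h1 h2]
        gcongr
        linarith

theorem lpBound_mean_sub_mean {X : Type*} [MeasurableSpace X] {p : ℝ} (hp : 1 ≤ p) (N : ℕ)
    [NeZero N] (μ : Fin N → Measure X) [∀ i, IsProbabilityMeasure (μ i)] {f : X → ℝ}
    (hf : Measurable f) {K : ℝ} (hK : ∀ x, |f x| ≤ K) :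
    LpBound p (Measure.pi μ)
      (fun x => (∑ i, f (x i)) / N - (∑ i, ∫ v, f v ∂(μ i)) / N)
      (momentConst p * K / Real.sqrt N) := by
  have hN : (0 : ℝ) < N := by exact_mod_cast Nat.pos_of_ne_zero (NeZero.ne N)
  have hK0 : 0 ≤ K := by
    obtain ⟨x⟩ := nonempty_of_isProbabilityMeasure (μ 0)
    exact (abs_nonneg _).trans (hK x)
  -- The degenerate case is separated because the rescaling below divides by $K$.
  rcases hK0.eq_or_lt with rfl | hK0
  · have h0 : f = fun _ => 0 := funext fun x => abs_nonpos_iff.1 (hK x)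
    subst h0
    simpa using LpBound.zero
  have hY : ∀ i, HasSubgaussianMGF (fun x => f x - ∫ v, f v ∂(μ i))
      ((‖K - -K‖₊ / 2) ^ 2) (μ i) := fun i =>
    hasSubgaussianMGF_of_mem_Icc hf.aemeasurable (Eventually.of_forall fun x => abs_le.1 (hK x))
  have hind : iIndepFun (fun i (x : Fin N → X) => f (x i) - ∫ v, f v ∂(μ i)) (Measure.pi μ) :=
    iIndepFun_pi (X := fun i x => f x - ∫ v, f v ∂(μ i)) fun i => (hf.sub_const _).aemeasurable
  have hS := HasSubgaussianMGF.sum_of_iIndepFun hind (s := Finset.univ)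
    (c := fun _ => (‖K - -K‖₊ / 2) ^ 2) fun i _ =>
      HasSubgaussianMGF.of_map (X := fun x => f x - ∫ v, f v ∂(μ i)) (Y := fun x : Fin N → X => x i)
        (measurable_pi_apply i).aemeasurable
        (by rw [(measurePreserving_eval μ i).map_eq]; exact hY i)
  -- Hoeffding's lemma gives variance proxy $K^2$ per summand, hence $NK^2$ for the sum; the factor
  -- $1/(K\sqrt N)$ normalises it to $1$.
  obtain ⟨c, hc, hsub⟩ : ∃ c : NNReal,
      (c : ℝ) = (1 / (K * Real.sqrt N)) ^ 2 * ((∑ _i : Fin N, (‖K - -K‖₊ / 2) ^ 2 : NNReal) : ℝ) ∧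
        HasSubgaussianMGF (fun x : Fin N → X =>
          1 / (K * Real.sqrt N) * ∑ i, (f (x i) - ∫ v, f v ∂(μ i))) c (Measure.pi μ) :=
    ⟨_, NNReal.coe_mul _ _, hS.const_mul _⟩
  have hc1 : c = 1 := by
    rw [← NNReal.coe_inj, hc]
    push_cast
    rw [Real.norm_eq_abs, abs_of_pos (by linarith), Finset.sum_const,
      Finset.card_univ, Fintype.card_fin, nsmul_eq_mul, div_pow, mul_pow, Real.sq_sqrt hN.le]
    field_simp
    ring
  rw [hc1] at hsub
  have h := (LpBound.of_hasSubgaussianMGF hp hsub).const_mul (a := K / Real.sqrt N) (by positivity)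
  have hs : Real.sqrt N * Real.sqrt N = N := Real.mul_self_sqrt hN.le
  have hs0 : Real.sqrt N ≠ 0 := (Real.sqrt_pos.2 hN).ne'
  have hfun : (fun x : Fin N → X => (∑ i, f (x i)) / N - (∑ i, ∫ v, f v ∂(μ i)) / N) =
      fun x => K / Real.sqrt N *
        (1 / (K * Real.sqrt N) * ∑ i, (f (x i) - ∫ v, f v ∂(μ i))) := by
    funext x
    rw [Finset.sum_sub_distrib, ← mul_assoc, div_mul_div_comm, mul_one, mul_left_comm, hs, ← sub_div, mul_comm K]
    field_simp
  rw [hfun]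
  exact h.weaken (le_of_eq (by ring))

theorem bregman_halfSq {d : ℕ} (a b : Param d) : bregman (halfSq d) a b = ‖a - b‖ ^ 2 / 2 := by
  rw [bregman, gradient_halfSq, halfSq, halfSq, inner_sub_right, real_inner_self_eq_norm_sq,
    @norm_sub_sq_real, real_inner_comm]
  ring

/-! ### Normalised weights -/

/-- Numerator and normaliser each change by a factor at most $e^{\delta}$, so each normalised weight
is at least $e^{-2\delta}\ge 1-2\delta$ times the other. The bound is linear for every $\delta\ge0$,
not only small ones, which matters because $\delta$ will be random. -/
theorem abs_sum_normalized_sub_le {N : ℕ} [NeZero N] {a b φ : Fin N → ℝ} {δ K : ℝ}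
    (ha : ∀ i, 0 < a i) (hb : ∀ i, 0 < b i) (hab : ∀ i, a i ≤ Real.exp δ * b i)
    (hba : ∀ i, b i ≤ Real.exp δ * a i) (hδ : 0 ≤ δ) (hφ : ∀ i, |φ i| ≤ K) :
    |∑ i, a i / (∑ j, a j) * φ i - ∑ i, b i / (∑ j, b j) * φ i| ≤ 4 * δ * K := by
  have hcomp : ∀ {u v : Fin N → ℝ}, (∀ i, 0 < u i) → (∀ i, 0 < v i) →
      (∀ i, u i ≤ Real.exp δ * v i) → (∀ i, v i ≤ Real.exp δ * u i) →
      ∀ i, (1 - 2 * δ) * (u i / ∑ j, u j) ≤ v i / ∑ j, v j := by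
    intro u v hu hv huv hvu i
    have hU : 0 < ∑ j, u j := Finset.sum_pos (fun j _ => hu j) Finset.univ_nonempty
    have hV : 0 < ∑ j, v j := Finset.sum_pos (fun j _ => hv j) Finset.univ_nonempty
    have hVU : ∑ j, v j ≤ Real.exp δ * ∑ j, u j := by
      rw [Finset.mul_sum]
      exact Finset.sum_le_sum fun j _ => hvu j
    have h1 : 1 - 2 * δ ≤ Real.exp (-(2 * δ)) := by linarith [Real.add_one_le_exp (-(2 * δ))]
    have h2 : Real.exp (-(2 * δ)) * (Real.exp δ * Real.exp δ) = 1 := by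
      rw [← Real.exp_add, ← Real.exp_add, ← Real.exp_zero]
      ring_nf
    have hui : 0 < u i / ∑ j, u j := div_pos (hu i) hU
    refine (mul_le_mul_of_nonneg_right h1 hui.le).trans ?_
    rw [mul_div_assoc', div_le_div_iff₀ hU hV]
    calc Real.exp (-(2 * δ)) * u i * ∑ j, v j
        ≤ Real.exp (-(2 * δ)) * (Real.exp δ * v i) * (Real.exp δ * ∑ j, u j) := by
          gcongr
          exact mul_nonneg (Real.exp_pos _).le (mul_nonneg (Real.exp_pos _).le (hv i).le)
          exact huv i
      _ = Real.exp (-(2 * δ)) * (Real.exp δ * Real.exp δ) * (v i * ∑ j, u j) := by ring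
      _ = v i * ∑ j, u j := by rw [h2, one_mul]
  have hA : 0 < ∑ j, a j := Finset.sum_pos (fun j _ => ha j) Finset.univ_nonempty
  have hB : 0 < ∑ j, b j := Finset.sum_pos (fun j _ => hb j) Finset.univ_nonempty
  rw [← Finset.sum_sub_distrib]
  refine (Finset.abs_sum_le_sum_abs _ _).trans ?_
  calc ∑ i, |a i / (∑ j, a j) * φ i - b i / (∑ j, b j) * φ i|
      -- Bounding by the sum of the two normalised weights covers both signs; each family sums to
      -- one, whence the $4$.
      ≤ ∑ i, 2 * δ * (a i / (∑ j, a j) + b i / (∑ j, b j)) * K := by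
        refine Finset.sum_le_sum fun i _ => ?_
        have h1 := hcomp ha hb hab hba i
        have h2 := hcomp hb ha hba hab i
        have h3 : 0 < a i / ∑ j, a j := div_pos (ha i) hA
        have h4 : 0 < b i / ∑ j, b j := div_pos (hb i) hB
        rw [← sub_mul, abs_mul]
        refine mul_le_mul (abs_le.2 ⟨?_, ?_⟩) (hφ i) (abs_nonneg _) (by positivity)
        · nlinarith [mul_nonneg hδ h3.le]
        · nlinarith [mul_nonneg hδ h4.le]
    _ = 4 * δ * K := by
        rw [← Finset.sum_mul, ← Finset.mul_sum, Finset.sum_add_distrib, ← Finset.sum_div,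
          ← Finset.sum_div, div_self hA.ne', div_self hB.ne']
        ring

/-- With $r$ the self-normalised mean,
$r-A/B=B^{-1}\big[(\text{numerator}-A)+r\,(B-\text{denominator})\big]$ and $|r|\le K$. Only the
deterministic $B$ is inverted, so the random denominator needs no lower bound. -/
theorem abs_sum_normalized_sub_div_le {N : ℕ} [NeZero N] {w φ : Fin N → ℝ} {K A B : ℝ}
    (hw : ∀ i, 0 < w i) (hφ : ∀ i, |φ i| ≤ K) (hB : 0 < B) :
    |∑ i, w i / (∑ j, w j) * φ i - A / B| ≤
      B⁻¹ * (|(∑ i, φ i * w i) / N - A| + K * |(∑ i, w i) / N - B|) := by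
  have hN : (0 : ℝ) < N := by exact_mod_cast Nat.pos_of_ne_zero (NeZero.ne N)
  have hS : 0 < ∑ j, w j := Finset.sum_pos (fun j _ => hw j) Finset.univ_nonempty
  set r := ∑ i, w i / (∑ j, w j) * φ i with hr
  have hrK : |r| ≤ K := by
    refine (Finset.abs_sum_le_sum_abs _ _).trans ?_
    calc ∑ i, |w i / (∑ j, w j) * φ i| ≤ ∑ i, w i / (∑ j, w j) * K := by
          refine Finset.sum_le_sum fun i _ => ?_
          rw [abs_mul, abs_of_pos (div_pos (hw i) hS)]
          exact mul_le_mul_of_nonneg_left (hφ i) (div_pos (hw i) hS).le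
      _ = K := by rw [← Finset.sum_mul, ← Finset.sum_div, div_self hS.ne', one_mul]
  have hrS : r * ∑ j, w j = ∑ i, φ i * w i := by
    rw [hr, Finset.sum_mul]
    refine Finset.sum_congr rfl fun i _ => ?_
    field_simp
  have hid : r - A / B = B⁻¹ * (((∑ i, φ i * w i) / N - A) + r * (B - (∑ i, w i) / N)) := by
    rw [← hrS]
    field_simp
    ring
  rw [hid, abs_mul, abs_of_pos (inv_pos.2 hB)]
  refine mul_le_mul_of_nonneg_left ((abs_add_le _ _).trans ?_) (inv_pos.2 hB).le
  rw [abs_mul, abs_sub_comm B]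
  exact add_le_add le_rfl (mul_le_mul_of_nonneg_right hrK (abs_nonneg _))

namespace LatentModel

variable {d : ℕ} {X : Type*} [MeasurableSpace X] (m : LatentModel d X)

/-! ### Regularity of the potential -/

/-- Convexity gives $U(a)-U(b)\le\langle\nabla U(a),a-b\rangle$; this is used in both orders. -/
theorem abs_U_sub_le {l : ℝ} (hl : 0 ≤ l) (hconv : m.RelConvex (halfSq d) l) {B : ℝ}
    (hB : ∀ θ x, ‖m.gradU θ x‖ ≤ B) (θ θ' : Param d) (x : X) :
    |m.U θ x - m.U θ' x| ≤ B * ‖θ - θ'‖ := by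
  have key : ∀ a b : Param d, m.U a x - m.U b x ≤ B * ‖a - b‖ := by
    intro a b
    have h1 := hconv x a b
    have h2 : 0 ≤ l * bregman (halfSq d) b a := by
      rw [bregman_halfSq]; positivity
    have h3 := (abs_le.1 (abs_real_inner_le_norm (m.gradU a x) (b - a))).1
    have h4 : ‖m.gradU a x‖ * ‖b - a‖ ≤ B * ‖b - a‖ :=
      mul_le_mul_of_nonneg_right (hB a x) (norm_nonneg _)
    rw [norm_sub_rev b a] at h4 h3
    linarith
  rw [abs_le]
  have h := key θ' θ
  rw [norm_sub_rev] at h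
  exact ⟨by linarith, key θ θ'⟩

/-- Let $g$ be the gradient difference and $z$ the point reached from $\theta'$ by the step $-g/L$.
Adding smoothness from $\theta'$ to $z$, convexity from $\theta$ to $z$ and smoothness from $\theta$
to $\theta'$ cancels all values of $U$ and leaves $\|g\|^2/(2L)\le L\|\theta'-\theta\|^2/2$. -/
theorem norm_gradU_sub_le {l L : ℝ} (hl : 0 ≤ l) (hL : 0 < L) (hconv : m.RelConvex (halfSq d) l)
    (hsmooth : m.RelSmooth (halfSq d) L) (θ θ' : Param d) (x : X) :
    ‖m.gradU θ x - m.gradU θ' x‖ ≤ L * ‖θ - θ'‖ := by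
  set g := m.gradU θ' x - m.gradU θ x with hg
  set z := θ' - L⁻¹ • g with hz
  have h1 := hsmooth x θ' z
  have h2 := hconv x θ z
  have h3 := hsmooth x θ θ'
  have h4 : 0 ≤ l * bregman (halfSq d) z θ := by rw [bregman_halfSq]; positivity
  have e1 : z - θ' = -(L⁻¹ • g) := by rw [hz]; abel
  have e2 : z - θ = (θ' - θ) - L⁻¹ • g := by rw [hz]; abel
  have e3 : inner ℝ (m.gradU θ' x) g - inner ℝ (m.gradU θ x) g = ‖g‖ ^ 2 := by
    rw [← inner_sub_left, ← hg, real_inner_self_eq_norm_sq]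
  rw [bregman_halfSq, e1, norm_neg, norm_smul, inner_neg_right, real_inner_smul_right,
    Real.norm_eq_abs, abs_of_pos (inv_pos.2 hL)] at h1
  rw [e2, inner_sub_right, real_inner_smul_right] at h2
  rw [bregman_halfSq] at h3
  have e4 : L * ((L⁻¹ * ‖g‖) ^ 2 / 2) = L⁻¹ * ‖g‖ ^ 2 / 2 := by field_simp
  rw [e4] at h1
  have e5 : L⁻¹ * ‖g‖ ^ 2 / 2 ≤ L * (‖θ' - θ‖ ^ 2 / 2) := by
    have : L⁻¹ * inner ℝ (m.gradU θ' x) g - L⁻¹ * inner ℝ (m.gradU θ x) g = L⁻¹ * ‖g‖ ^ 2 := by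
      rw [← mul_sub, e3]
    linarith
  have e6 : ‖g‖ ^ 2 ≤ (L * ‖θ' - θ‖) ^ 2 := by
    have := mul_le_mul_of_nonneg_left e5 (by positivity : 0 ≤ 2 * L)
    field_simp at this
    nlinarith
  rw [norm_sub_rev, norm_sub_rev θ, ← hg]
  exact le_of_sq_le_sq e6 (by positivity)

/-! ### The densities along a sequence of parameters -/

/-- The unnormalised density `mu0^{∏ (1 - γ_k)} ∏_j p_{θ_j}^{γ_{j+1} ∏ (1 - γ_k)}`. -/
def geomMix (γ : ℕ → ℝ) (n : ℕ) (θ : ℕ → Param d) (x : X) : ℝ :=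
  m.mu0 x ^ (∏ k ∈ Finset.Icc 1 n, (1 - γ k)) *
    ∏ j ∈ Finset.range n, m.p (θ j) x ^ (γ (j + 1) * ∏ k ∈ Finset.Icc (j + 2) n, (1 - γ k))

theorem geomMix_pos (γ : ℕ → ℝ) (n : ℕ) (θ : ℕ → Param d) (x : X) : 0 < m.geomMix γ n θ x :=
  mul_pos (Real.rpow_pos_of_pos (m.mu0_pos x) _)
    (Finset.prod_pos fun _ _ => Real.rpow_pos_of_pos (m.p_pos _ _) _)

theorem weight_eq (γ : ℕ → ℝ) (n : ℕ) (θ : ℕ → Param d) (x : X) :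
    m.weight γ n θ x = (m.p (θ n) x / m.geomMix γ n θ x) ^ γ (n + 1) := rfl

/-- Up to the constant $Z^{-c}$, which normalisation removes, the geometric update of the density
$ZD$ is multiplication by the weight $(q/D)^c$. -/
theorem mul_rpow_one_sub_mul_rpow {Z D q c : ℝ} (hZ : 0 < Z) (hD : 0 < D) (hq : 0 < q) :
    (Z * D) ^ (1 - c) * q ^ c = Z ^ (-c) * (Z * D * (q / D) ^ c) := by
  rw [Real.rpow_sub (mul_pos hZ hD), Real.rpow_one, Real.mul_rpow hZ.le hD.le,
    Real.div_rpow hq.le hD.le, Real.rpow_neg hZ.le]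
  have := Real.rpow_pos_of_pos hZ c
  have := Real.rpow_pos_of_pos hD c
  field_simp

theorem geomMix_succ (γ : ℕ → ℝ) (n : ℕ) (θ : ℕ → Param d) (x : X) :
    m.geomMix γ (n + 1) θ x = m.geomMix γ n θ x * m.weight γ n θ x := by
  have h := mul_rpow_one_sub_mul_rpow (c := γ (n + 1)) one_pos (m.geomMix_pos γ n θ x) (m.p_pos (θ n) x)
  rw [one_mul, Real.one_rpow, one_mul, ← weight_eq] at h
  -- The new factor $j=n$ has an empty product in its exponent; every older exponent gains the
  -- factor $1-\gamma_{n+1}$.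
  rw [← h, geomMix, geomMix, Finset.prod_range_succ, Finset.prod_Icc_succ_top (by omega),
    Finset.Icc_eq_empty (a := n + 2) (by omega), Finset.prod_empty, mul_one,
    Real.mul_rpow (Real.rpow_pos_of_pos (m.mu0_pos x) _).le
      (Finset.prod_nonneg fun _ _ => (Real.rpow_pos_of_pos (m.p_pos _ _) _).le),
    ← Real.rpow_mul (m.mu0_pos x).le,
    ← Real.finsetProd_rpow _ _ fun _ _ => (Real.rpow_pos_of_pos (m.p_pos _ _) _).le, ← mul_assoc]
  refine congrArg₂ _ (congrArg₂ _ rfl ?_) rfl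
  refine Finset.prod_congr rfl fun j hj => ?_
  rw [Finset.prod_Icc_succ_top (by have := Finset.mem_range.1 hj; omega),
    ← Real.rpow_mul (m.p_pos _ _).le, mul_assoc]

theorem weight_meas (γ : ℕ → ℝ) (n : ℕ) (θ : ℕ → Param d) : Measurable (m.weight γ n θ) :=
  (m.measurable_weight γ n).comp measurable_prodMk_left

theorem integrable_of_integral_eq_one {f : X → ℝ} {μ : Measure X} (h : ∫ x, f x ∂μ = 1) :
    Integrable f μ := by
  by_contra hc
  rw [integral_undef hc] at h
  exact zero_ne_one h

variable {m} in
-- These facts are proved together because they feed one another: unit mass and a bounded weight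
-- make the next normaliser finite, the explicit positive form of the density makes it positive, and
-- only then is the next density again of unit mass.
theorem muAlong_spec {γ : ℕ → ℝ} (hw : m.WeightsBounded γ) (θ : ℕ → Param d) (n : ℕ) :
    (∃ Z : ℝ, 0 < Z ∧ ∀ x, m.muAlong γ θ n x = Z * m.geomMix γ n θ x) ∧
      Measurable (m.muAlong γ θ n) ∧ ∫ x, m.muAlong γ θ n x ∂m.ref = 1 ∧
      0 < ∫ x, m.weight γ n θ x * m.muAlong γ θ n x ∂m.ref ∧
      ∀ x, m.muAlong γ θ (n + 1) x = m.weight γ n θ x * m.muAlong γ θ n x /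
        ∫ v, m.weight γ n θ v * m.muAlong γ θ n v ∂m.ref := by
  have hpos : ∀ n, (∃ Z : ℝ, 0 < Z ∧ ∀ x, m.muAlong γ θ n x = Z * m.geomMix γ n θ x) →
      Measurable (m.muAlong γ θ n) → ∫ x, m.muAlong γ θ n x ∂m.ref = 1 →
      (Integrable (fun x => m.weight γ n θ x * m.muAlong γ θ n x) m.ref ∧
      0 < ∫ x, m.weight γ n θ x * m.muAlong γ θ n x ∂m.ref) := by
    rintro n ⟨Z, hZ, hZx⟩ hmeas hone
    obtain ⟨K, hK⟩ := hw n θ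
    have hi : Integrable (fun x => m.weight γ n θ x * m.muAlong γ θ n x) m.ref := by
      refine (integrable_of_integral_eq_one hone).bdd_mul (m.weight_meas γ n θ).aestronglyMeasurable
        (c := K) (Eventually.of_forall fun x => ?_)
      rw [Real.norm_eq_abs, abs_of_pos (m.weight_pos _ _ _ _)]
      exact hK x
    have hp : ∀ x, 0 < m.weight γ n θ x * m.muAlong γ θ n x := fun x => by
      rw [hZx]
      exact mul_pos (m.weight_pos _ _ _ _) (mul_pos hZ (m.geomMix_pos _ _ _ _))
    refine ⟨hi, ?_⟩
    rw [integral_pos_iff_support_of_nonneg (fun x => (hp x).le) hi,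
      Function.support_eq_univ fun x => (hp x).ne']
    -- If the dominating measure were zero, the density could not have mass one.
    refine pos_iff_ne_zero.2 fun h0 => ?_
    rw [Measure.measure_univ_eq_zero.1 h0] at hone
    simp at hone
  have hsucc : ∀ n, (∃ Z : ℝ, 0 < Z ∧ ∀ x, m.muAlong γ θ n x = Z * m.geomMix γ n θ x) →
      ∀ x, m.muAlong γ θ (n + 1) x = m.weight γ n θ x * m.muAlong γ θ n x /
        ∫ v, m.weight γ n θ v * m.muAlong γ θ n v ∂m.ref := by
    rintro n ⟨Z, hZ, hZx⟩ x
    have hnum : ∀ x, m.muAlong γ θ n x ^ (1 - γ (n + 1)) * m.p (θ n) x ^ γ (n + 1) =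
        Z ^ (-γ (n + 1)) * (m.weight γ n θ x * m.muAlong γ θ n x) := fun x => by
      rw [hZx, mul_rpow_one_sub_mul_rpow hZ (m.geomMix_pos _ _ _ _) (m.p_pos _ _), weight_eq]
      ring
    simp only [muAlong, muStep, hnum]
    rw [integral_const_mul, mul_div_mul_left _ _ (Real.rpow_pos_of_pos hZ _).ne']
  have main : (∃ Z : ℝ, 0 < Z ∧ ∀ x, m.muAlong γ θ n x = Z * m.geomMix γ n θ x) ∧
      Measurable (m.muAlong γ θ n) ∧ ∫ x, m.muAlong γ θ n x ∂m.ref = 1 := by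
    induction n with
    | zero => exact ⟨⟨1, one_pos, fun x => by simp [muAlong, geomMix]⟩, m.mu0_meas, m.mu0_mass⟩
    | succ n ih =>
      obtain ⟨h1, h2, h3⟩ := ih
      obtain ⟨hi, hI⟩ := hpos n h1 h2 h3
      have hs := hsucc n h1
      obtain ⟨Z, hZ, hZx⟩ := h1
      refine ⟨⟨Z / ∫ v, m.weight γ n θ v * m.muAlong γ θ n v ∂m.ref, div_pos hZ hI, fun x => ?_⟩,
        ?_, ?_⟩
      · rw [hs, hZx, geomMix_succ]
        ring
      · rw [funext hs]
        exact ((m.weight_meas γ n θ).mul h2).div_const _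
      · simp only [hs]
        rw [integral_div, div_self hI.ne']
  exact ⟨main.1, main.2.1, main.2.2, (hpos n main.1 main.2.1 main.2.2).2, hsucc n main.1⟩

/-- The distribution with density `μ_n(· ; θ_{0:n-1})`. -/
def muMeasure (γ : ℕ → ℝ) (θ : ℕ → Param d) (n : ℕ) : Measure X :=
  m.ref.withDensity fun x => ENNReal.ofReal (m.muAlong γ θ n x)

variable {m}

theorem muAlong_pos {γ : ℕ → ℝ} (hw : m.WeightsBounded γ) (θ : ℕ → Param d) (n : ℕ) (x : X) :
    0 < m.muAlong γ θ n x := by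
  obtain ⟨Z, hZ, h⟩ := (muAlong_spec hw θ n).1
  rw [h]
  exact mul_pos hZ (m.geomMix_pos _ _ _ _)

theorem isProbabilityMeasure_muMeasure {γ : ℕ → ℝ} (hw : m.WeightsBounded γ) (θ : ℕ → Param d)
    (n : ℕ) : IsProbabilityMeasure (m.muMeasure γ θ n) := by
  have h := (muAlong_spec hw θ n).2.2.1
  constructor
  rw [muMeasure, withDensity_apply _ MeasurableSet.univ, Measure.restrict_univ,
    ← ofReal_integral_eq_lintegral_ofReal (integrable_of_integral_eq_one h)
      (Filter.Eventually.of_forall fun x => (muAlong_pos hw θ n x).le), h, ENNReal.ofReal_one]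

theorem integral_muMeasure {γ : ℕ → ℝ} (hw : m.WeightsBounded γ) (θ : ℕ → Param d) (n : ℕ)
    {E : Type*} [NormedAddCommGroup E] [NormedSpace ℝ E] (φ : X → E) :
    ∫ x, φ x ∂(m.muMeasure γ θ n) = ∫ x, m.muAlong γ θ n x • φ x ∂m.ref := by
  rw [muMeasure, integral_withDensity_eq_integral_toReal_smul
    (muAlong_spec hw θ n).2.1.ennreal_ofReal (Eventually.of_forall fun x => ENNReal.ofReal_lt_top)]
  simp only [ENNReal.toReal_ofReal (muAlong_pos hw θ n _).le]

theorem integral_weight_pos {γ : ℕ → ℝ} (hw : m.WeightsBounded γ) (θ : ℕ → Param d) (n : ℕ) :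
    0 < ∫ x, m.weight γ n θ x ∂(m.muMeasure γ θ n) := by
  rw [integral_muMeasure hw]
  simpa only [smul_eq_mul, mul_comm] using (muAlong_spec hw θ n).2.2.2.1

theorem integral_muMeasure_succ {γ : ℕ → ℝ} (hw : m.WeightsBounded γ) (θ : ℕ → Param d) (n : ℕ)
    (φ : X → ℝ) :
    ∫ x, φ x ∂(m.muMeasure γ θ (n + 1)) =
      (∫ x, φ x * m.weight γ n θ x ∂(m.muMeasure γ θ n)) /
        ∫ x, m.weight γ n θ x ∂(m.muMeasure γ θ n) := by
  rw [integral_muMeasure hw, integral_muMeasure hw, integral_muMeasure hw, ← integral_div]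
  refine integral_congr_ae (Eventually.of_forall fun x => ?_)
  simp only [(muAlong_spec hw θ n).2.2.2.2, smul_eq_mul]
  rw [integral_congr_ae (Eventually.of_forall fun x => mul_comm (m.muAlong γ θ n x) _)]
  ring

variable (m)

theorem iter_snd (h : Param d → ℝ) (γ : ℕ → ℝ) (θ0 : Param d) (n : ℕ) :
    (m.iter h γ θ0 n).2 = m.muAlong γ (fun j => (m.iter h γ θ0 j).1) n := by
  induction n with
  | zero => rfl
  | succ n ih => simp only [iter, muAlong, ← ih]

/-! ### Dependence of the weights on the parameters -/

theorem prod_one_sub_mem {γ : ℕ → ℝ} (hγ : ∀ n, 1 ≤ n → 0 ≤ γ n ∧ γ n ≤ 1) {a : ℕ} (ha : 1 ≤ a)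
    (n : ℕ) : 0 ≤ ∏ k ∈ Finset.Icc a n, (1 - γ k) ∧ ∏ k ∈ Finset.Icc a n, (1 - γ k) ≤ 1 := by
  have h : ∀ k ∈ Finset.Icc a n, 0 ≤ 1 - γ k ∧ 1 - γ k ≤ 1 := fun k hk => by
    have := hγ k (ha.trans (Finset.mem_Icc.1 hk).1)
    exact ⟨by linarith, by linarith⟩
  exact ⟨Finset.prod_nonneg fun k hk => (h k hk).1,
    Finset.prod_le_one (fun k hk => (h k hk).1) fun k hk => (h k hk).2⟩

/-- The logarithm is affine in the values $U(\theta_j,x)$, and the `mu0` term does not involve the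
parameters, so it cancels when two parameter sequences are compared. -/
theorem log_weight (γ : ℕ → ℝ) (n : ℕ) (θ : ℕ → Param d) (x : X) :
    Real.log (m.weight γ n θ x) = γ (n + 1) * (-m.U (θ n) x -
      ((∏ k ∈ Finset.Icc 1 n, (1 - γ k)) * Real.log (m.mu0 x) -
        ∑ j ∈ Finset.range n, γ (j + 1) * (∏ k ∈ Finset.Icc (j + 2) n, (1 - γ k)) *
          m.U (θ j) x)) := by
  have hp : ∀ j ∈ Finset.range n,
      m.p (θ j) x ^ (γ (j + 1) * ∏ k ∈ Finset.Icc (j + 2) n, (1 - γ k)) ≠ 0 := fun j _ =>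
    (Real.rpow_pos_of_pos (m.p_pos _ _) _).ne'
  rw [weight_eq, Real.log_rpow (div_pos (m.p_pos _ _) (m.geomMix_pos _ _ _ _)),
    Real.log_div (m.p_pos _ _).ne' (m.geomMix_pos _ _ _ _).ne', geomMix,
    Real.log_mul (Real.rpow_pos_of_pos (m.mu0_pos x) _).ne' (Finset.prod_ne_zero_iff.2 hp),
    Real.log_rpow (m.mu0_pos x), Real.log_prod hp, U, neg_neg, sub_eq_add_neg (_ * _) (∑ j ∈ _, _),
    ← Finset.sum_neg_distrib]
  congr 3
  refine Finset.sum_congr rfl fun j _ => ?_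
  rw [Real.log_rpow (m.p_pos _ _), U]
  ring

/-- In the log-weight, the coefficient of each $U(\theta_j,x)$ has absolute value at most $1$,
because all step sizes lie in $[0,1]$. -/
theorem weight_le_exp_mul {γ : ℕ → ℝ} (hγ : ∀ n, 1 ≤ n → 0 ≤ γ n ∧ γ n ≤ 1) {B : ℝ} (hB0 : 0 ≤ B)
    (hB : ∀ θ θ' x, |m.U θ x - m.U θ' x| ≤ B * ‖θ - θ'‖) (n : ℕ) (θ θ' : ℕ → Param d) (x : X) :
    m.weight γ n θ x ≤
      Real.exp (B * ∑ j ∈ Finset.range (n + 1), ‖θ j - θ' j‖) * m.weight γ n θ' x := by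
  have hw := m.weight_pos γ n θ x
  have hw' := m.weight_pos γ n θ' x
  rw [← Real.log_le_log_iff hw (mul_pos (Real.exp_pos _) hw'),
    Real.log_mul (Real.exp_pos _).ne' hw'.ne', Real.log_exp, ← sub_le_iff_le_add, log_weight,
    log_weight, ← mul_sub]
  have h1 : (-m.U (θ n) x - ((∏ k ∈ Finset.Icc 1 n, (1 - γ k)) * Real.log (m.mu0 x) -
        ∑ j ∈ Finset.range n, γ (j + 1) * (∏ k ∈ Finset.Icc (j + 2) n, (1 - γ k)) *
          m.U (θ j) x)) -
      (-m.U (θ' n) x - ((∏ k ∈ Finset.Icc 1 n, (1 - γ k)) * Real.log (m.mu0 x) -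
        ∑ j ∈ Finset.range n, γ (j + 1) * (∏ k ∈ Finset.Icc (j + 2) n, (1 - γ k)) *
          m.U (θ' j) x)) =
      ∑ j ∈ Finset.range n, γ (j + 1) * (∏ k ∈ Finset.Icc (j + 2) n, (1 - γ k)) *
          (m.U (θ j) x - m.U (θ' j) x) + (m.U (θ' n) x - m.U (θ n) x) := by
    simp only [mul_sub, Finset.sum_sub_distrib]
    ring
  have hR : B * ∑ j ∈ Finset.range (n + 1), ‖θ j - θ' j‖ =
      ∑ j ∈ Finset.range n, B * ‖θ j - θ' j‖ + B * ‖θ n - θ' n‖ := by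
    rw [Finset.sum_range_succ, mul_add, Finset.mul_sum]
  rw [h1, hR]
  obtain ⟨hc0, hc1⟩ := hγ (n + 1) (by omega)
  have h2 : ∑ j ∈ Finset.range n, γ (j + 1) * (∏ k ∈ Finset.Icc (j + 2) n, (1 - γ k)) *
      (m.U (θ j) x - m.U (θ' j) x) ≤ ∑ j ∈ Finset.range n, B * ‖θ j - θ' j‖ := by
    refine Finset.sum_le_sum fun j _ => ?_
    obtain ⟨h0, h1⟩ := hγ (j + 1) (by omega)
    obtain ⟨h2, h3⟩ := prod_one_sub_mem hγ (a := j + 2) (by omega) n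
    refine (mul_le_mul_of_nonneg_left ((le_abs_self _).trans (hB (θ j) (θ' j) x))
      (mul_nonneg h0 h2)).trans ?_
    exact mul_le_of_le_one_left (mul_nonneg hB0 (norm_nonneg _)) (mul_le_one₀ h1 h2 h3)
  have h3 : m.U (θ' n) x - m.U (θ n) x ≤ B * ‖θ n - θ' n‖ := by
    rw [norm_sub_rev]
    exact (le_abs_self _).trans (hB _ _ _)
  have h4 : 0 ≤ ∑ j ∈ Finset.range n, B * ‖θ j - θ' j‖ + B * ‖θ n - θ' n‖ :=
    add_nonneg (Finset.sum_nonneg fun j _ => mul_nonneg hB0 (norm_nonneg _))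
      (mul_nonneg hB0 (norm_nonneg _))
  exact (mul_le_mul_of_nonneg_left (add_le_add h2 h3) hc0).trans
    (mul_le_of_le_one_left h4 hc1)

end LatentModel

/-! ### Coordinates, bounded integrands and invariant kernels. -/

theorem norm_le_sum_abs_apply {d : ℕ} (v : Param d) : ‖v‖ ≤ ∑ k, |v k| := by
  calc ‖v‖ = ‖∑ k, v k • EuclideanSpace.single k (1 : ℝ)‖ := by
        congr 1
        ext j
        simp [Finset.sum_apply, Pi.single_apply]
    _ ≤ ∑ k, ‖v k • EuclideanSpace.single k (1 : ℝ)‖ := norm_sum_le _ _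
    _ = ∑ k, |v k| := by simp [norm_smul]

theorem abs_apply_le_norm {d : ℕ} (v : Param d) (k : Fin d) : |v k| ≤ ‖v‖ := by
  simpa using PiLp.norm_apply_le v k

theorem integrable_of_abs_le {X : Type*} [MeasurableSpace X] (μ : Measure X) [IsFiniteMeasure μ]
    {φ : X → ℝ} (hφ : Measurable φ) {K : ℝ} (hK : ∀ x, |φ x| ≤ K) : Integrable φ μ :=
  Integrable.of_bound hφ.aestronglyMeasurable K (Eventually.of_forall hK)

theorem abs_integral_le_of_abs_le {X : Type*} [MeasurableSpace X] (μ : Measure X)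
    [IsProbabilityMeasure μ] {φ : X → ℝ} {K : ℝ} (hK : ∀ x, |φ x| ≤ K) : |∫ x, φ x ∂μ| ≤ K := by
  have h := norm_integral_le_of_norm_le_const (μ := μ) (f := φ) (Eventually.of_forall hK)
  simpa using h

theorem nonempty_latent {d : ℕ} {X : Type*} [MeasurableSpace X] (m : LatentModel d X) :
    Nonempty X := nonempty_of_isProbabilityMeasure m.mu0Measure

/-- Averaging a bounded function over a Markov kernel that leaves `μ` invariant. -/
theorem integral_integral_of_invariant {X : Type*} [MeasurableSpace X] {μ : Measure X}
    [IsFiniteMeasure μ] {κ : Kernel X X} (hκ : κ.Invariant μ) {φ : X → ℝ} (hφ : Measurable φ)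
    {K : ℝ} (hK : ∀ x, |φ x| ≤ K) : ∫ x, ∫ v, φ v ∂(κ x) ∂μ = ∫ x, φ x ∂μ := by
  have h : (κ ∘ₖ Kernel.const X μ) = Kernel.const X μ := hκ.comp_const
  rcases isEmpty_or_nonempty X with _ | ⟨⟨x⟩⟩
  · simp [Measure.eq_zero_of_isEmpty μ]
  have hi := Kernel.integral_comp (η := κ) (κ := Kernel.const X μ) (a := x) (f := φ)
  rw [h, Kernel.const_apply] at hi
  exact (hi (integrable_of_abs_le μ hφ hK)).symm

namespace LatentModel

variable {d : ℕ} {X : Type*} [MeasurableSpace X] (m : LatentModel d X)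

/-! ### One iteration of the algorithm -/

/-- The joint law of the state at time `n`, the resampled particles and the proposed particles. -/
def jointLaw (γ : ℕ → ℝ) (M : (n : ℕ) → Kernel ((Fin n → Param d) × X) X)
    [∀ n, IsMarkovKernel (M n)] (θ0 : Param d) (N : ℕ) [NeZero N] (n : ℕ) :
    Measure ((State d X N × (Fin N → X)) × (Fin N → X)) :=
  (m.law γ M θ0 N n ⊗ₘ m.resample γ N n) ⊗ₘ propose M N n

/-- The state at time `n + 1` as a function of the state at time `n` and the new particles. -/
def nextState (γ : ℕ → ℝ) {N : ℕ} (n : ℕ) (q : (State d X N × (Fin N → X)) × (Fin N → X)) :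
    State d X N :=
  (m.thetaUpdate γ n q.1.1, q.2)

theorem measurable_nextState (γ : ℕ → ℝ) {N : ℕ} (n : ℕ) :
    Measurable (m.nextState (N := N) γ n) :=
  ((m.measurable_thetaUpdate γ n).comp (measurable_fst.comp measurable_fst)).prodMk measurable_snd

/-- The joint law keeps the resampled particles, which the law of the next state integrates out, so
that the noises of the two draws can be bounded by conditioning one after the other. -/
theorem law_succ (γ : ℕ → ℝ) (M : (n : ℕ) → Kernel ((Fin n → Param d) × X) X)
    [∀ n, IsMarkovKernel (M n)] (θ0 : Param d) (N : ℕ) [NeZero N] (n : ℕ) :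
    m.law γ M θ0 N (n + 1) = (m.jointLaw γ M θ0 N n).map (m.nextState γ n) := by
  refine Measure.ext_of_lintegral _ fun f hf => ?_
  have hT := m.measurable_nextState (N := N) γ n
  have hfT : Measurable fun q => f (m.nextState (N := N) γ n q) := hf.comp hT
  rw [lintegral_map hf hT, jointLaw, Measure.lintegral_compProd (f := fun q => f (m.nextState γ n q))
      hfT, Measure.lintegral_compProd (Measurable.lintegral_kernel_prod_right' hfT)]
  rw [law, Measure.lintegral_bind (Kernel.aemeasurable _) hf.aemeasurable]
  refine lintegral_congr fun s => ?_
  have hg : Measurable fun c : Fin N → X => f (m.thetaUpdate γ n s, c) :=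
    hf.comp measurable_prodMk_left
  rw [step, Kernel.lintegral_deterministic_prod _ _ _ hf, Kernel.lintegral_comp _ _ _ hg,
    Kernel.lintegral_id_prod hg.lintegral_kernel]
  rfl

theorem thetaUpdate_of_le (γ : ℕ → ℝ) {N : ℕ} {n j : ℕ} (hj : j ≤ n) (s : State d X N) :
    m.thetaUpdate γ n s j = s.1 j := by
  rw [thetaUpdate, Function.update_of_ne (by omega)]

theorem thetaUpdate_succ (γ : ℕ → ℝ) {N : ℕ} (n : ℕ) (s : State d X N) :
    m.thetaUpdate γ n s (n + 1) =
      s.1 n - γ (n + 1) • ∑ i, m.W γ n s i • m.gradU (s.1 n) (s.2 i) := by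
  rw [thetaUpdate, Function.update_self, mirrorStep_halfSq]

theorem measurable_weightedMean (γ : ℕ → ℝ) {N : ℕ} (n : ℕ) {φ : X → ℝ} (hφ : Measurable φ) :
    Measurable fun s : State d X N => ∑ i, m.W γ n s i * φ (s.2 i) :=
  Finset.measurable_sum _ fun i _ => (m.measurable_W γ n i).mul
    (hφ.comp ((measurable_pi_apply i).comp measurable_snd))

theorem measurable_mean {N : ℕ} {φ : X → ℝ} (hφ : Measurable φ) :
    Measurable fun x : Fin N → X => (∑ i, φ (x i)) / (N : ℝ) :=
  (Finset.measurable_sum _ fun i _ => hφ.comp (measurable_pi_apply i)).div_const _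

theorem integral_resampleOne (γ : ℕ → ℝ) {N : ℕ} (n : ℕ) (s : State d X N) {φ : X → ℝ}
    (hφ : Measurable φ) :
    ∫ x, φ x ∂(m.resampleOne γ n s) = ∑ i, m.W γ n s i * φ (s.2 i) := by
  have hi : ∀ i ∈ Finset.univ, Integrable φ
      (ENNReal.ofReal (m.W γ n s i) • Measure.dirac (s.2 i)) := fun i _ =>
    (integrable_dirac' hφ.stronglyMeasurable (by simp)).smul_measure ENNReal.ofReal_ne_top
  rw [resampleOne, integral_finsetSum_measure hi]
  refine Finset.sum_congr rfl fun i _ => ?_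
  rw [integral_smul_measure, integral_dirac' _ _ hφ.stronglyMeasurable,
    ENNReal.toReal_ofReal (m.W_nonneg γ n s i), smul_eq_mul]

/-! ### Propagation of the error through one iteration. -/

theorem lpBound_resample {p : ℝ} (hp : 1 ≤ p) (γ : ℕ → ℝ) (N : ℕ) [NeZero N] (n : ℕ)
    (s : State d X N) {φ : X → ℝ} (hφ : Measurable φ) {K : ℝ}
    (hK : ∀ x, |φ x| ≤ K) :
    LpBound p (m.resample γ N n s)
      (fun y => (∑ i, φ (y i)) / N - ∑ i, m.W γ n s i * φ (s.2 i))
      (momentConst p * K / Real.sqrt N) := by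
  have hN : (N : ℝ) ≠ 0 := by exact_mod_cast NeZero.ne N
  cases n with
  | zero =>
    have hmeas : Measurable fun y : Fin N → X =>
        (∑ i, φ (y i)) / N - ∑ i, m.W γ 0 s i * φ (s.2 i) := (measurable_mean hφ).sub_const _
    -- At time zero nothing is resampled and the weights are $1/N$, so the difference vanishes
    -- almost surely.
    refine ⟨hmeas.aestronglyMeasurable, ?_⟩
    have h0 : (fun y : Fin N → X => (∑ i, φ (y i)) / N - ∑ i, m.W γ 0 s i * φ (s.2 i))
        =ᵐ[m.resample γ N 0 s] 0 := by
      rw [resample, Kernel.deterministic_apply]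
      refine (ae_dirac_iff (measurableSet_eq_fun hmeas measurable_const)).2 ?_
      simp only [W, ← Finset.mul_sum]
      rw [one_div_mul_eq_div]
      exact sub_self _
    rw [eLpNorm_congr_ae h0, eLpNorm_zero]
    exact zero_le
  | succ n =>
    have h := lpBound_mean_sub_mean hp N (fun _ : Fin N => m.resampleOne γ (n + 1) s) hφ hK
    rw [Finset.sum_const, Finset.card_univ, Fintype.card_fin, nsmul_eq_mul,
      mul_div_cancel_left₀ _ hN, integral_resampleOne _ _ _ _ hφ] at h
    exact h

theorem measurable_integral_kernel {M : (n : ℕ) → Kernel ((Fin n → Param d) × X) X}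
    [∀ n, IsMarkovKernel (M n)] (n : ℕ) {φ : X → ℝ} (hφ : Measurable φ) :
    Measurable fun q : (Fin n → Param d) × X => ∫ v, φ v ∂(M n q) :=
  (hφ.stronglyMeasurable.integral_kernel).measurable

/-- The constant collects two sampling errors, the kernel perturbation $\rho nD$ and the inherited
$C$. Only the parameters with index $j<n$ enter, as the kernel reads no others. -/
theorem lpBound_jointLaw {p : ℝ} (hp : 1 ≤ p) {γ : ℕ → ℝ}
    {M : (n : ℕ) → Kernel ((Fin n → Param d) × X) X} [∀ n, IsMarkovKernel (M n)] (θ0 : Param d)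
    (hw : m.WeightsBounded γ) (hinv : m.KernelsInvariant γ M) (N : ℕ) [NeZero N] (n : ℕ)
    (ϑ : ℕ → Param d) {ρ : ℝ} (hρ0 : 0 ≤ ρ)
    (hρ : ∀ φ : X → ℝ, Measurable φ → (∃ K : ℝ, ∀ x, |φ x| ≤ K) →
      ∀ (θ θ' : Fin n → Param d) (x : X),
        |∫ v, φ v ∂(M n (θ, x)) - ∫ v, φ v ∂(M n (θ', x))| ≤
          ρ * (⨆ v, |φ v|) * ∑ j, ‖θ j - θ' j‖) {C D : ℝ} (hC : 0 ≤ C) (hD : 0 ≤ D)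
    (hparticle : ∀ φ : X → ℝ, Measurable φ → ∀ K : ℝ, 0 ≤ K → (∀ x, |φ x| ≤ K) →
      LpBound p (m.law γ M θ0 N n)
        (fun s => ∑ i, m.W γ n s i * φ (s.2 i) - ∫ x, φ x ∂(m.muMeasure γ ϑ n))
        (C * K / Real.sqrt N))
    (hparam : ∀ j < n, LpBound p (m.law γ M θ0 N n) (fun s => ‖s.1 j - ϑ j‖) (D / Real.sqrt N))
    {φ : X → ℝ} (hφ : Measurable φ) {K : ℝ} (hK0 : 0 ≤ K) (hK : ∀ x, |φ x| ≤ K) :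
    LpBound p (m.jointLaw γ M θ0 N n)
      (fun q => (∑ i, φ (q.2 i)) / N - ∫ x, φ x ∂(m.muMeasure γ ϑ n))
      ((2 * momentConst p + ρ * n * D + C) * K / Real.sqrt N) := by
  have hN : (0 : ℝ) < N := by exact_mod_cast Nat.pos_of_ne_zero (NeZero.ne N)
  have hm := momentConst_nonneg p
  have := isProbabilityMeasure_muMeasure hw ϑ n
  have := nonempty_latent m
  set κφ : (Fin n → Param d) × X → ℝ := fun q => ∫ v, φ v ∂(M n q) with hκφ
  have hκm : Measurable κφ := measurable_integral_kernel n hφ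
  set ψ : X → ℝ := fun x => κφ (fun j : Fin n => ϑ j, x) with hψ
  have hψm : Measurable ψ := hκm.comp measurable_prodMk_left
  have hψK : ∀ x, |ψ x| ≤ K := fun x => abs_integral_le_of_abs_le _ hK
  have hθm : Measurable fun q : State d X N × (Fin N → X) => fun j : Fin n => q.1.1 j :=
    measurable_pi_lambda _ fun j => (measurable_pi_apply _).comp (measurable_fst.comp measurable_fst)
  have hκmean : Measurable fun q : State d X N × (Fin N → X) =>
      (∑ i, κφ (fun j : Fin n => q.1.1 j, q.2 i)) / (N : ℝ) :=
    (Finset.measurable_sum _ fun i _ =>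
      hκm.comp (hθm.prodMk ((measurable_pi_apply i).comp measurable_snd))).div_const _
  -- Proposal noise: given the state and the resampled particles, the new particles are independent
  -- but not identically distributed.
  have h1 : LpBound p (m.jointLaw γ M θ0 N n)
      (fun q => (∑ i, φ (q.2 i)) / N - (∑ i, κφ (fun j : Fin n => q.1.1.1 j, q.1.2 i)) / N)
      (momentConst p * K / Real.sqrt N) := by
    refine LpBound.compProd hp (((measurable_mean hφ).comp measurable_snd).sub
      -- The bound below holds for each fixed past `q`.
      (hκmean.comp measurable_fst)) fun q => ?_
    exact lpBound_mean_sub_mean hp N (fun i => M n (fun j : Fin n => q.1.1 j, q.2 i)) hφ hK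
  have h2 : LpBound p (m.law γ M θ0 N n ⊗ₘ m.resample γ N n)
      (fun q => (∑ i, κφ (fun j : Fin n => q.1.1 j, q.2 i)) / N - (∑ i, ψ (q.2 i)) / N)
      (ρ * K * (n * (D / Real.sqrt N))) := by
    have hs := LpBound.sum hp (Finset.univ : Finset (Fin n)) (fun j _ => hparam j j.2)
      fun _ _ => by positivity
    rw [Finset.sum_const, Finset.card_univ, Fintype.card_fin, nsmul_eq_mul] at hs
    refine ((hs.comp_fst (m.resample γ N n)).const_mul (a := ρ * K) (by positivity)).mono
      (hκmean.sub ((measurable_mean hψm).comp measurable_snd)).aestronglyMeasurable fun q => ?_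
    refine le_trans ?_ (le_abs_self _)
    rw [← sub_div, ← Finset.sum_sub_distrib, abs_div, abs_of_pos hN, div_le_iff₀ hN]
    refine (Finset.abs_sum_le_sum_abs _ _).trans ?_
    refine (Finset.sum_le_card_nsmul _ _ (ρ * K * ∑ j : Fin n, ‖q.1.1 j - ϑ j‖)
      fun i _ => ?_).trans (le_of_eq ?_)
    · refine (hρ φ hφ ⟨K, hK⟩ _ _ _).trans ?_
      gcongr
      exact ciSup_le hK
    · rw [Finset.card_univ, Fintype.card_fin, nsmul_eq_mul, mul_comm]
  -- From here on the test function is `ψ`, built with the deterministic parameters, so the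
  -- resampling bound and the induction hypothesis apply to it.
  have h3 : LpBound p (m.law γ M θ0 N n ⊗ₘ m.resample γ N n)
      (fun q => (∑ i, ψ (q.2 i)) / N - ∑ i, m.W γ n q.1 i * ψ (q.1.2 i))
      (momentConst p * K / Real.sqrt N) :=
    LpBound.compProd hp (((measurable_mean hψm).comp measurable_snd).sub
      ((m.measurable_weightedMean γ n hψm).comp measurable_fst)) fun s =>
        m.lpBound_resample hp γ N n s hψm hψK
  have h4 := (hparticle ψ hψm K hK0 hψK).comp_fst (m.resample γ N n)
  have hinv' : ∫ x, ψ x ∂(m.muMeasure γ ϑ n) = ∫ x, φ x ∂(m.muMeasure γ ϑ n) :=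
    integral_integral_of_invariant (μ := m.muMeasure γ ϑ n) (hinv n ϑ) hφ hK
  have h234 := ((h2.add hp h3 (by positivity) (by positivity)).add hp h4 (by positivity)
    (by positivity)).comp_fst (propose M N n)
  have h := h1.add hp h234 (by positivity) (by positivity)
  have h' := h.weaken (c' := (2 * momentConst p + ρ * n * D + C) * K / Real.sqrt N)
    (le_of_eq (by ring))
  convert h' using 1
  funext q
  rw [← hinv']
  ring

theorem measurable_gradU_apply (θ : Param d) (k : Fin d) : Measurable fun x => m.gradU θ x k :=
  (EuclideanSpace.proj (𝕜 := ℝ) k).continuous.measurable.comp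
    (m.measurable_gradU.comp measurable_prodMk_left)

theorem integral_gradU_apply {μ : Measure X} [IsFiniteMeasure μ] {B : ℝ}
    (hB : ∀ θ x, ‖m.gradU θ x‖ ≤ B) (θ : Param d) (k : Fin d) :
    (∫ x, m.gradU θ x ∂μ) k = ∫ x, m.gradU θ x k ∂μ := by
  have hi : Integrable (fun x => m.gradU θ x) μ :=
    Integrable.of_bound (m.measurable_gradU.comp measurable_prodMk_left).aestronglyMeasurable B
      (Eventually.of_forall (hB θ))
  exact ((EuclideanSpace.proj (𝕜 := ℝ) k).integral_comp_comm hi).symm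

/-- The old error, the Lipschitz change of the gradient at the particles, and the particle error for
$\nabla_\theta U$ at the exact parameter add up. The last is estimated coordinate by coordinate,
which costs the factor $d$. -/
theorem lpBound_thetaUpdate {p : ℝ} (hp : 1 ≤ p) {γ : ℕ → ℝ}
    {M : (n : ℕ) → Kernel ((Fin n → Param d) × X) X} [∀ n, IsMarkovKernel (M n)] (θ0 : Param d)
    (hw : m.WeightsBounded γ) {B L : ℝ} (hB0 : 0 ≤ B) (hB : ∀ θ x, ‖m.gradU θ x‖ ≤ B)
    (hL0 : 0 ≤ L) (hL : ∀ θ θ' x, ‖m.gradU θ x - m.gradU θ' x‖ ≤ L * ‖θ - θ'‖) (N : ℕ) [NeZero N]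
    (n : ℕ) (hγ0 : 0 ≤ γ (n + 1)) (ϑ : ℕ → Param d)
    (hϑ : ϑ (n + 1) = ϑ n - γ (n + 1) • ∫ x, m.gradU (ϑ n) x ∂(m.muMeasure γ ϑ n))
    {C c : ℝ} (hC : 0 ≤ C) (hc : 0 ≤ c)
    (hparticle : ∀ φ : X → ℝ, Measurable φ → ∀ K : ℝ, 0 ≤ K → (∀ x, |φ x| ≤ K) →
      LpBound p (m.law γ M θ0 N n)
        (fun s => ∑ i, m.W γ n s i * φ (s.2 i) - ∫ x, φ x ∂(m.muMeasure γ ϑ n))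
        (C * K / Real.sqrt N))
    (hparam : LpBound p (m.law γ M θ0 N n) (fun s => ‖s.1 n - ϑ n‖) c) :
    LpBound p (m.law γ M θ0 N n) (fun s => ‖m.thetaUpdate γ n s (n + 1) - ϑ (n + 1)‖)
      (c + γ (n + 1) * (L * c + d * (C * B / Real.sqrt N))) := by
  have := isProbabilityMeasure_muMeasure hw ϑ n
  have hcoord : ∀ k ∈ (Finset.univ : Finset (Fin d)), LpBound p (m.law γ M θ0 N n)
      (fun s => |∑ i, m.W γ n s i * m.gradU (ϑ n) (s.2 i) k -
        ∫ x, m.gradU (ϑ n) x k ∂(m.muMeasure γ ϑ n)|) (C * B / Real.sqrt N) := fun k _ =>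
    (hparticle _ (m.measurable_gradU_apply _ k) B hB0 fun x =>
      (abs_apply_le_norm _ k).trans (hB _ x)).abs
  have hsum := LpBound.sum hp _ hcoord fun _ _ => by positivity
  rw [Finset.sum_const, Finset.card_univ, Fintype.card_fin, nsmul_eq_mul] at hsum
  have h := hparam.add hp (((hparam.const_mul hL0).add hp hsum (by positivity)
    (by positivity)).const_mul hγ0) hc (by positivity)
  refine h.mono ?_ fun s => ?_
  · have h1 : Measurable fun s : State d X N => m.thetaUpdate γ n s (n + 1) :=
      (measurable_pi_apply _).comp (m.measurable_thetaUpdate γ n)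
    exact (h1.sub_const _).norm.aestronglyMeasurable
  refine le_trans ?_ (le_abs_self _)
  rw [abs_norm, thetaUpdate_succ, hϑ]
  set G := ∫ x, m.gradU (ϑ n) x ∂(m.muMeasure γ ϑ n) with hG
  have hsplit : s.1 n - γ (n + 1) • (∑ i, m.W γ n s i • m.gradU (s.1 n) (s.2 i)) -
      (ϑ n - γ (n + 1) • G) =
      (s.1 n - ϑ n) - γ (n + 1) •
        (∑ i, m.W γ n s i • (m.gradU (s.1 n) (s.2 i) - m.gradU (ϑ n) (s.2 i)) +
          (∑ i, m.W γ n s i • m.gradU (ϑ n) (s.2 i) - G)) := by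
    simp only [smul_sub, Finset.sum_sub_distrib, sub_add_sub_cancel]
    abel
  rw [hsplit]
  refine (norm_sub_le _ _).trans (add_le_add le_rfl ?_)
  rw [norm_smul, Real.norm_eq_abs, abs_of_nonneg hγ0]
  refine mul_le_mul_of_nonneg_left ((norm_add_le _ _).trans (add_le_add ?_ ?_)) hγ0
  · refine (norm_sum_le _ _).trans ?_
    calc ∑ i, ‖m.W γ n s i • (m.gradU (s.1 n) (s.2 i) - m.gradU (ϑ n) (s.2 i))‖
        ≤ ∑ i, m.W γ n s i * (L * ‖s.1 n - ϑ n‖) := by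
          refine Finset.sum_le_sum fun i _ => ?_
          rw [norm_smul, Real.norm_eq_abs, abs_of_nonneg (m.W_nonneg γ n s i)]
          exact mul_le_mul_of_nonneg_left (hL _ _ _) (m.W_nonneg γ n s i)
      _ = L * ‖s.1 n - ϑ n‖ := by rw [← Finset.sum_mul, sum_W, one_mul]
  · refine (norm_le_sum_abs_apply _).trans (le_of_eq ?_)
    refine Finset.sum_congr rfl fun k _ => ?_
    rw [PiLp.sub_apply, hG, integral_gradU_apply m hB]
    simp

/-- The term with $4B(n+1)D$ pays for replacing the random weights by those at `ϑ`. The other term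
is the ratio estimate for the test functions $\varphi w$ and $w$, whence the $2$. -/
theorem lpBound_weightedMean_succ {p : ℝ} (hp : 1 ≤ p) {γ : ℕ → ℝ}
    {M : (n : ℕ) → Kernel ((Fin n → Param d) × X) X} [∀ n, IsMarkovKernel (M n)] (θ0 : Param d)
    (hw : m.WeightsBounded γ) (hγ : ∀ n, 1 ≤ n → 0 ≤ γ n ∧ γ n ≤ 1) {B : ℝ} (hB0 : 0 ≤ B)
    (hB : ∀ θ θ' x, |m.U θ x - m.U θ' x| ≤ B * ‖θ - θ'‖) (N : ℕ) [NeZero N]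
    (n : ℕ) (ϑ : ℕ → Param d) {C D Kw : ℝ} (hC : 0 ≤ C) (hD : 0 ≤ D)
    (hKw : ∀ x, m.weight γ n ϑ x ≤ Kw)
    (hmean : ∀ φ : X → ℝ, Measurable φ → ∀ K : ℝ, 0 ≤ K → (∀ x, |φ x| ≤ K) →
      LpBound p (m.jointLaw γ M θ0 N n)
        (fun q => (∑ i, φ (q.2 i)) / N - ∫ x, φ x ∂(m.muMeasure γ ϑ n)) (C * K / Real.sqrt N))
    (hparam : ∀ j ≤ n, LpBound p (m.law γ M θ0 N n) (fun s => ‖s.1 j - ϑ j‖) (D / Real.sqrt N))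
    {φ : X → ℝ} (hφ : Measurable φ) {K : ℝ} (hK0 : 0 ≤ K) (hK : ∀ x, |φ x| ≤ K) :
    LpBound p (m.law γ M θ0 N (n + 1))
      (fun s => ∑ i, m.W γ (n + 1) s i * φ (s.2 i) - ∫ x, φ x ∂(m.muMeasure γ ϑ (n + 1)))
      ((4 * B * (n + 1) * D + 2 * (∫ x, m.weight γ n ϑ x ∂(m.muMeasure γ ϑ n))⁻¹ * C * Kw) * K /
        Real.sqrt N) := by
  have hI := integral_weight_pos hw ϑ n
  have hwm := m.weight_meas γ n ϑ
  have hwpos := m.weight_pos γ n ϑ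
  have habs : ∀ x, |m.weight γ n ϑ x| ≤ Kw := fun x => by
    rw [abs_of_pos (hwpos x)]
    exact hKw x
  obtain ⟨x0⟩ := nonempty_latent m
  have hKw0 : 0 ≤ Kw := (abs_nonneg _).trans (habs x0)
  have hmeas := (m.measurable_weightedMean (N := N) γ (n + 1) hφ).sub_const
    (∫ x, φ x ∂(m.muMeasure γ ϑ (n + 1)))
  have h1 := hmean _ (hφ.mul hwm) (K * Kw) (by positivity) fun x => by
    rw [Pi.mul_apply, abs_mul]
    exact mul_le_mul (hK x) (habs x) (abs_nonneg _) hK0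
  have h2 := hmean _ hwm Kw hKw0 habs
  have h3 := LpBound.sum hp (Finset.range (n + 1))
    (fun j hj => hparam j (Nat.lt_succ_iff.1 (Finset.mem_range.1 hj))) fun _ _ => by positivity
  rw [Finset.sum_const, Finset.card_range, nsmul_eq_mul] at h3
  have h4 := ((h3.comp_fst (m.resample γ N n)).comp_fst (propose M N n)).const_mul
    (a := 4 * B * K) (by positivity)
  have h5 := (h1.abs.add hp (h2.abs.const_mul hK0) (by positivity) (by positivity)).const_mul
    (inv_nonneg.2 hI.le)
  have h6 := h4.add hp h5 (by positivity)
    (mul_nonneg (inv_nonneg.2 hI.le) (by positivity))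
  rw [law_succ]
  refine LpBound.of_comp_map (m.measurable_nextState γ n) hmeas.aestronglyMeasurable ?_
  refine (h6.mono (hmeas.comp (m.measurable_nextState γ n)).aestronglyMeasurable
    fun q => ?_).weaken (le_of_eq (by push_cast; ring))
  refine le_trans ?_ (le_abs_self _)
  -- The weight reads only the parameters $0,\dots,n$, which the update leaves unchanged; their
  -- errors at time $n$ suffice.
  have hle : ∀ x, m.weight γ n (m.thetaUpdate γ n q.1.1) x ≤
      Real.exp (B * ∑ j ∈ Finset.range (n + 1), ‖q.1.1.1 j - ϑ j‖) * m.weight γ n ϑ x := by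
    intro x
    refine (m.weight_le_exp_mul hγ hB0 hB n _ ϑ x).trans (le_of_eq ?_)
    congr 3
    refine Finset.sum_congr rfl fun j hj => ?_
    rw [thetaUpdate_of_le _ _ (Nat.lt_succ_iff.1 (Finset.mem_range.1 hj))]
  have hge : ∀ x, m.weight γ n ϑ x ≤
      Real.exp (B * ∑ j ∈ Finset.range (n + 1), ‖q.1.1.1 j - ϑ j‖) *
        m.weight γ n (m.thetaUpdate γ n q.1.1) x := by
    intro x
    refine (m.weight_le_exp_mul hγ hB0 hB n ϑ (m.thetaUpdate γ n q.1.1) x).trans (le_of_eq ?_)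
    congr 3
    refine Finset.sum_congr rfl fun j hj => ?_
    rw [thetaUpdate_of_le _ _ (Nat.lt_succ_iff.1 (Finset.mem_range.1 hj)), norm_sub_rev]
  have e1 := abs_sum_normalized_sub_le (φ := fun i => φ (q.2 i))
    (fun i => m.weight_pos γ n (m.thetaUpdate γ n q.1.1) (q.2 i))
    (fun i => hwpos (q.2 i)) (fun i => hle (q.2 i)) (fun i => hge (q.2 i))
    (mul_nonneg hB0 (Finset.sum_nonneg fun _ _ => norm_nonneg _)) fun i => hK (q.2 i)
  have e2 := abs_sum_normalized_sub_div_le (φ := fun i => φ (q.2 i))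
    (A := ∫ x, φ x * m.weight γ n ϑ x ∂(m.muMeasure γ ϑ n)) (fun i => hwpos (q.2 i))
    (fun i => hK (q.2 i)) hI
  rw [← integral_muMeasure_succ hw] at e2
  refine (abs_sub_le _ (∑ i, m.weight γ n ϑ (q.2 i) / (∑ j, m.weight γ n ϑ (q.2 j)) * φ (q.2 i))
    _).trans (add_le_add (e1.trans (le_of_eq (by ring))) e2)

/-- The induction on time. All indices $j\le n$ are kept in the hypothesis. At $j=0$ the factor is
$0$, since $\theta_0^N$ is exact while $\gamma_0$ is arbitrary, possibly negative. -/
theorem exists_lpBound {p : ℝ} (hp : 1 ≤ p) {γ : ℕ → ℝ}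
    {M : (n : ℕ) → Kernel ((Fin n → Param d) × X) X} [∀ n, IsMarkovKernel (M n)] (θ0 : Param d)
    (hinv : m.KernelsInvariant γ M) {l L : ℝ} (hl : 0 ≤ l) (hL : 0 < L)
    (hconv : m.RelConvex (halfSq d) l) (hsmooth : m.RelSmooth (halfSq d) L)
    (hstable : KernelsStable M) (hw : m.WeightsBounded γ) (hgrad : m.GradBounded)
    (hγ : ∀ n, 1 ≤ n → 0 ≤ γ n ∧ γ n ≤ γ (n + 1) ∧ γ n ≤ 1) (ϑ : ℕ → Param d) (hϑ0 : ϑ 0 = θ0)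
    (hϑ : ∀ n, ϑ (n + 1) = ϑ n - γ (n + 1) • ∫ x, m.gradU (ϑ n) x ∂(m.muMeasure γ ϑ n)) (n : ℕ) :
    ∃ C D : ℝ, 0 ≤ C ∧ 0 ≤ D ∧ ∀ (N : ℕ) [NeZero N],
      (∀ φ : X → ℝ, Measurable φ → ∀ K : ℝ, 0 ≤ K → (∀ x, |φ x| ≤ K) →
        LpBound p (m.law γ M θ0 N n)
          (fun s => ∑ i, m.W γ n s i * φ (s.2 i) - ∫ x, φ x ∂(m.muMeasure γ ϑ n))
          (C * K / Real.sqrt N)) ∧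
      ∀ j ≤ n, LpBound p (m.law γ M θ0 N n) (fun s => ‖s.1 j - ϑ j‖)
        (D * (if j = 0 then 0 else γ j) / Real.sqrt N) := by
  obtain ⟨B, hB⟩ := hgrad
  obtain ⟨x0⟩ := nonempty_latent m
  have hB0 : 0 ≤ B := (norm_nonneg _).trans (hB 0 x0)
  have hU := m.abs_U_sub_le hl hconv hB
  have hLip := m.norm_gradU_sub_le hl hL hconv hsmooth
  have hg : ∀ j, 0 ≤ (if j = 0 then 0 else γ j) ∧ (if j = 0 then 0 else γ j) ≤ 1 ∧
      (if j = 0 then 0 else γ j) ≤ γ (j + 1) := by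
    intro j
    split_ifs with h
    · exact ⟨le_rfl, zero_le_one, (hγ (j + 1) (by omega)).1⟩
    · have := hγ j (by omega)
      exact ⟨this.1, this.2.2, this.2.1⟩
  induction n with
  | zero =>
    refine ⟨momentConst p, 0, momentConst_nonneg p, le_rfl, fun N _ => ⟨?_, ?_⟩⟩
    · intro φ hφ K _ hK
      have hN : (N : ℝ) ≠ 0 := by exact_mod_cast NeZero.ne N
      have h := lpBound_mean_sub_mean hp N (fun _ : Fin N => m.mu0Measure) hφ hK
      rw [Finset.sum_const, Finset.card_univ, Fintype.card_fin, nsmul_eq_mul,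
        mul_div_cancel_left₀ _ hN] at h
      have hsnd : (m.law γ M θ0 N 0).map Prod.snd = Measure.pi fun _ : Fin N => m.mu0Measure := by
        rw [law, Measure.map_snd_prod, measure_univ, one_smul]
      rw [← hsnd] at h
      convert h.comp_map measurable_snd using 1
      funext s
      simp only [W, ← Finset.mul_sum]
      rw [one_div_mul_eq_div]
      rfl
    · intro j hj
      obtain rfl : j = 0 := by omega
      have hm : Measurable fun s : State d X N => ‖s.1 0 - ϑ 0‖ :=
        (((measurable_pi_apply 0).comp measurable_fst).sub_const _).norm
      refine ⟨hm.aestronglyMeasurable, ?_⟩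
      have hm' : Measurable fun t : ℕ → Param d => ‖t 0 - ϑ 0‖ :=
        ((measurable_pi_apply 0).sub_const _).norm
      have hfst : (m.law γ M θ0 N 0).map Prod.fst = Measure.dirac fun _ => θ0 := by
        rw [law, Measure.map_fst_prod, measure_univ, one_smul]
      have h0 : (fun s : State d X N => ‖s.1 0 - ϑ 0‖) =ᵐ[m.law γ M θ0 N 0] 0 := by
        refine ae_of_ae_map (f := Prod.fst) (p := fun t : ℕ → Param d => ‖t 0 - ϑ 0‖ = 0)
          measurable_fst.aemeasurable ?_
        rw [hfst]
        refine (ae_dirac_iff (measurableSet_eq_fun hm' measurable_const)).2 ?_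
        simp [hϑ0]
      rw [eLpNorm_congr_ae h0, eLpNorm_zero]
      exact zero_le
  | succ n ih =>
    obtain ⟨C, D, hC, hD, ih⟩ := ih
    obtain ⟨ρ, hρ0, hρ⟩ := hstable n
    obtain ⟨Kw, hKw⟩ := hw n ϑ
    have hKw0 : 0 ≤ Kw := (m.weight_pos γ n ϑ x0).le.trans (hKw x0)
    have hI := integral_weight_pos hw ϑ n
    have hm := momentConst_nonneg p
    have hγ' : ∀ n, 1 ≤ n → 0 ≤ γ n ∧ γ n ≤ 1 := fun n hn => ⟨(hγ n hn).1, (hγ n hn).2.2⟩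
    -- The first witness is the reweighting constant with the proposal constant inserted for `C`.
    -- The second uses $\gamma_n\le\gamma_{n+1}$ for the old error `D` and $\gamma_n\le1$ in the
    -- Lipschitz term `L * D`.
    refine ⟨4 * B * (n + 1) * D + 2 * (∫ x, m.weight γ n ϑ x ∂(m.muMeasure γ ϑ n))⁻¹ *
      (2 * momentConst p + ρ * n * D + C) * Kw, D + L * D + d * C * B, ?_, by positivity,
      fun N _ => ?_⟩
    · have := inv_pos.2 hI
      positivity
    obtain ⟨hpart, hpar⟩ := ih N
    have hpar' : ∀ j ≤ n, LpBound p (m.law γ M θ0 N n) (fun s => ‖s.1 j - ϑ j‖)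
        (D / Real.sqrt N) := fun j hj =>
      (hpar j hj).weaken (div_le_div_of_nonneg_right (mul_le_of_le_one_right hD (hg j).2.1)
        (Real.sqrt_nonneg _))
    refine ⟨fun φ hφ K hK0 hK => ?_, fun j hj => ?_⟩
    · exact m.lpBound_weightedMean_succ hp θ0 hw hγ' hB0 hU N n ϑ (by positivity) hD hKw
        (fun ψ hψ K' hK0' hK' => m.lpBound_jointLaw hp θ0 hw hinv N n ϑ hρ0.le hρ hC hD hpart
          (fun j hj => hpar' j hj.le) hψ hK0' hK') hpar' hφ hK0 hK
    · have hmj : Measurable fun s : State d X N => ‖s.1 j - ϑ j‖ :=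
        (((measurable_pi_apply j).comp measurable_fst).sub_const _).norm
      rw [law_succ]
      refine LpBound.of_comp_map (m.measurable_nextState γ n) hmj.aestronglyMeasurable ?_
      refine LpBound.comp_fst (f := fun q : State d X N × (Fin N → X) =>
        ‖m.thetaUpdate γ n q.1 j - ϑ j‖) (propose M N n) ?_
      refine LpBound.comp_fst (f := fun s : State d X N =>
        ‖m.thetaUpdate γ n s j - ϑ j‖) (m.resample γ N n) ?_
      rcases Nat.lt_or_ge n j with h | h
      · obtain rfl : j = n + 1 := by omega
        obtain ⟨h0, h1, h2⟩ := hg n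
        obtain ⟨hc0, hc1⟩ := hγ' (n + 1) (by omega)
        refine (m.lpBound_thetaUpdate hp θ0 hw hB0 hB hL.le hLip N n hc0 ϑ (hϑ n) hC (by positivity)
          hpart (hpar n le_rfl)).weaken ?_
        rw [if_neg (Nat.succ_ne_zero n)]
        generalize (if n = 0 then 0 else γ n) = g at *
        have e1 : D * g ≤ D * γ (n + 1) := mul_le_mul_of_nonneg_left h2 hD
        have e2 : γ (n + 1) * (L * (D * g)) ≤ γ (n + 1) * (L * D) :=
          mul_le_mul_of_nonneg_left
            (mul_le_mul_of_nonneg_left (mul_le_of_le_one_right hD h1) hL.le) hc0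
        calc D * g / Real.sqrt N +
              γ (n + 1) * (L * (D * g / Real.sqrt N) + d * (C * B / Real.sqrt N))
            = (D * g + γ (n + 1) * (L * (D * g)) + γ (n + 1) * (d * C * B)) / Real.sqrt N := by
              ring
          _ ≤ (D * γ (n + 1) + γ (n + 1) * (L * D) + γ (n + 1) * (d * C * B)) / Real.sqrt N := by
              gcongr
          _ = (D + L * D + d * C * B) * γ (n + 1) / Real.sqrt N := by ring
      -- Older parameters are not modified, and the new constant is at least `D`.
      · simp only [m.thetaUpdate_of_le γ h]
        refine (hpar j h).weaken ?_
        have := (hg j).1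
        refine div_le_div_of_nonneg_right (mul_le_mul_of_nonneg_right ?_ this) (Real.sqrt_nonneg _)
        have : 0 ≤ L * D + d * C * B := by positivity
        linarith

end LatentModel

end MDLVM

end

/-! ### Transfer to the mirror descent iterates. -/

theorem proposition3 {d : ℕ} {X : Type*} [MeasurableSpace X] (m : MDLVM.LatentModel d X)
    (γ : ℕ → ℝ) (M : (n : ℕ) → Kernel ((Fin n → MDLVM.Param d) × X) X)
    [∀ n, IsMarkovKernel (M n)] (θ0 : MDLVM.Param d)
    (hinv : m.KernelsInvariant γ M)
    (l L : ℝ) (hl : 0 ≤ l) (hL : 0 < L)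
    (hconv : m.RelConvex (MDLVM.halfSq d) l) (hsmooth : m.RelSmooth (MDLVM.halfSq d) L)
    (hstable : MDLVM.KernelsStable M)
    (hweights : m.WeightsBounded γ) (hgrad : m.GradBounded)
    (hγ : ∀ n, 1 ≤ n → 0 ≤ γ n ∧ γ n ≤ γ (n + 1) ∧ γ n ≤ 1) :
    ∀ (n : ℕ) (p : ℝ), 1 ≤ p → ∃ C D : ℝ, 0 ≤ C ∧ 0 ≤ D ∧
      ∀ (N : ℕ) [NeZero N],
        (∀ φ : X → ℝ, Measurable φ → (∃ K : ℝ, ∀ x, |φ x| ≤ K) →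
          eLpNorm
              (fun s : MDLVM.State d X N => (∑ i, m.W γ n s i * φ (s.2 i)) -
                ∫ x, φ x * (m.iter (MDLVM.halfSq d) γ θ0 n).2 x ∂m.ref)
              (ENNReal.ofReal p) (m.law γ M θ0 N n) ≤
            ENNReal.ofReal (C * (⨆ x, |φ x|) / Real.sqrt N)) ∧
        eLpNorm
            (fun s : MDLVM.State d X N => s.1 n - (m.iter (MDLVM.halfSq d) γ θ0 n).1)
            (ENNReal.ofReal p) (m.law γ M θ0 N n) ≤
          ENNReal.ofReal (D * γ n / Real.sqrt N) := by
  intro n p hp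
  have hμ : ∀ k {E : Type} [NormedAddCommGroup E] [NormedSpace ℝ E] (φ : X → E),
      ∫ x, φ x ∂(m.muMeasure γ (fun j => (m.iter (MDLVM.halfSq d) γ θ0 j).1) k) =
        ∫ x, (m.iter (MDLVM.halfSq d) γ θ0 k).2 x • φ x ∂m.ref := fun k _ _ _ φ => by
    rw [MDLVM.LatentModel.integral_muMeasure hweights, m.iter_snd]
  obtain ⟨C, D, hC, hD, h⟩ := m.exists_lpBound hp θ0 hinv hl hL hconv hsmooth hstable hweights
    hgrad hγ (fun j => (m.iter (MDLVM.halfSq d) γ θ0 j).1) rfl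
    (fun k => by rw [hμ]; exact MDLVM.mirrorStep_halfSq _ _ _) n
  refine ⟨C, D, hC, hD, fun N _ => ⟨fun φ hφ ⟨K, hK⟩ => ?_, ?_⟩⟩
  · have hb : BddAbove (Set.range fun x => |φ x|) := ⟨K, by rintro _ ⟨x, rfl⟩; exact hK x⟩
    have := ((h N).1 φ hφ (⨆ x, |φ x|) (Real.iSup_nonneg fun x => abs_nonneg _)
      (le_ciSup hb)).norm_le
    rw [hμ] at this
    simpa only [smul_eq_mul, mul_comm (φ _)] using this
  · have hle := ((h N).2 n le_rfl).norm_le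
    rw [eLpNorm_norm] at hle
    refine hle.trans ?_
    -- For $n=0$ the bound obtained is $0$, so the sign of `γ 0` on the right does not matter.
    rcases Nat.eq_zero_or_pos n with rfl | hn
    · simp
    · rw [if_neg (by omega)]
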